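/- **Theorem 5.2.** Let $a<b$, $\Omega=(a,b)$, $0<\alpha<1$, $0<\sigma<1$, $r>0$, and $\mathcal L v(x)=\int_a^b \frac{v(y)-v(x)}{|x-y|^{\alpha}}\,dy$. Let $u$ solve $$u_t(x,t)-\mathcal L u(x,t)=f(x,t)\ \ (x\in\Omega,\ 0<t<1),\qquad u(x,0)=u_0(x)\ \ (x\in\Omega),\qquad u(x,t)=0\ \ (x\in\mathbb R\setminus\Omega,\ 0\le t\le 1).$$ Assume that $u(\cdot,t)\in C^2(\Omega)$ for every $t\in[0,1]$ and that, with a constant $K$, $$\left|\partial_x^{\ell}u(x,t)\right|\le K\,[(x-a)(b-x)]^{\sigma-\ell}\qquad(\ell=0,1,2,\ x\in\Omega,\ 0\le t\le 1),$$ and that $u(x,\cdot)\in C^3([0,1])$ for every $x\in\Omega$, with $\partial_t^3u$ bounded on $\Omega\times[0,1]$. For an integer $N\ge 1$ let $x_j=a+\frac{b-a}{2}\left(\frac jN\right)^r$ for $0\le j\le N$ and $x_j=b-\frac{b-a}{2}\left(2-\frac jN\right)^r$ for $N<j\le 2N$. Let $\phi_1,\dots,\phi_{2N-1}$ be the piecewise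 linear hat functions of this mesh at its interior nodes, and let $A=(a_{i,k})_{1\le i,k\le 2N-1}$ with $a_{i,k}=\int_a^b\frac{\phi_k(x_i)-\phi_k(y)}{|x_i-y|^{\alpha}}\,dy$. For an integer $M\ge 1$ let $\tau=1/M$ and $t_s=s\tau$, and let $U^k=(u_1^k,\dots,u_{2N-1}^k)^T$, $0\le k\le M$, be computed by the collocation Crank–Nicolson scheme $$u_i^0=u_0(x_i),\qquad \left(I+\tfrac{\tau}{2}A\right)U^{k}=\left(I-\tfrac{\tau}{2}A\right)U^{k-1}+\tau F^{k-\frac12}\quad(1\le k\le M),$$ where $F^{k-\frac12}=\big(f(x_1,t_{k-\frac12}),\dots,f(x_{2N-1},t_{k-\frac12})\big)^T$. Then there is a constant $C>0$, independent of $N$ and $M$, such that for all $N\ge1$ (with $N\ge2$ in the second case) and all $M\ge1$ $$\max_{\substack{1\le i\le 2N-1\\ 1\le k\le M}}|u(x_i,t_k)-u_i^k|\le \begin{cases} C\left(N^{-r(1+\sigma-\alpha)}+M^{-2}\right), & r(1+\sigma-\alpha)<2,\\ C\left(N^{-r(1+\sigma-\alpha)}\ln N+M^{-2}\right), & r(1+\sigma-\alpha)=2,\\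 C\left(N^{-2}+M^{-2}\right), & r(1+\sigma-\alpha)>2. \end{cases}$$ -/

import Mathlib

namespace NonlocalCN

open Set

noncomputable section

/-- The nonlocal operator `𝓛 v (x) = ∫_a^b (v(y) - v(x)) / |x - y|^α dy` on `Ω = (a, b)`. -/
def nonlocalOp (a b α : ℝ) (v : ℝ → ℝ) (x : ℝ) : ℝ :=
  ∫ y in a..b, (v y - v x) / |x - y| ^ α

/-- `u` solves `u_t - 𝓛 u = f` in `(a, b) × (0, 1)`, with initial value `u₀` and with `u = 0`
outside `(a, b)`. -/
structure IsSolution (a b α : ℝ) (u₀ : ℝ → ℝ) (f u : ℝ → ℝ → ℝ) : Prop where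
  equation : ∀ x ∈ Ioo a b, ∀ t ∈ Ioo (0 : ℝ) 1,
    HasDerivAt (fun s => u x s) (nonlocalOp a b α (fun y => u y t) x + f x t) t
  initial : ∀ x ∈ Ioo a b, u x 0 = u₀ x
  exterior : ∀ x ∉ Ioo a b, ∀ t ∈ Icc (0 : ℝ) 1, u x t = 0

/-- Low regularity in space, uniformly in time: `u(·, t)` is `C²` in `(a, b)` and
`|∂_x^ℓ u(x, t)| ≤ K [(x - a)(b - x)]^(σ - ℓ)` for `ℓ = 0, 1, 2`. -/
def SpaceRegular (a b σ : ℝ) (u : ℝ → ℝ → ℝ) : Prop :=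
  (∀ t ∈ Icc (0 : ℝ) 1, ContDiffOn ℝ 2 (fun x => u x t) (Ioo a b)) ∧
  ∃ K : ℝ, ∀ ℓ : ℕ, ℓ ≤ 2 → ∀ t ∈ Icc (0 : ℝ) 1, ∀ x ∈ Ioo a b,
    |iteratedDeriv ℓ (fun y => u y t) x| ≤ K * ((x - a) * (b - x)) ^ (σ - (ℓ : ℝ))

/-- Smoothness in time: each `u(x, ·)` is `C³` on `[0, 1]`, and `∂_t³ u` is bounded on
`(a, b) × [0, 1]`. -/
def TimeRegular (a b : ℝ) (u : ℝ → ℝ → ℝ) : Prop :=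
  (∀ x ∈ Ioo a b, ContDiffOn ℝ 3 (fun t => u x t) (Icc (0 : ℝ) 1)) ∧
  ∃ K : ℝ, ∀ x ∈ Ioo a b, ∀ t ∈ Icc (0 : ℝ) 1,
    |iteratedDerivWithin 3 (fun s => u x s) (Icc (0 : ℝ) 1) t| ≤ K

/-- The nodes `x_j`, `0 ≤ j ≤ 2N`, of the graded mesh on `[a, b]` with grading exponent `r`. -/
def node (a b r : ℝ) (N j : ℕ) : ℝ :=
  if j ≤ N then a + (b - a) / 2 * ((j : ℝ) / (N : ℝ)) ^ r
  else b - (b - a) / 2 * (2 - (j : ℝ) / (N : ℝ)) ^ r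

/-- The hat function `φ_j` of the partition `x`, for an interior node `x_j` (so `1 ≤ j`). -/
def hat (x : ℕ → ℝ) (j : ℕ) (y : ℝ) : ℝ :=
  if y ∈ Icc (x (j - 1)) (x j) then (y - x (j - 1)) / (x j - x (j - 1))
  else if y ∈ Icc (x j) (x (j + 1)) then (x (j + 1) - y) / (x (j + 1) - x j)
  else 0

/-- The coefficient `a_{i,k} = ∫_a^b (φ_k(x_i) - φ_k(y)) / |x_i - y|^α dy`. -/
def coeff (a b α r : ℝ) (N i k : ℕ) : ℝ :=
  ∫ y in a..b, (hat (node a b r N) k (node a b r N i) - hat (node a b r N) k y) /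
    |node a b r N i - y| ^ α

/-- The collocation matrix `A = (a_{i,k})`, `1 ≤ i, k ≤ 2N - 1`. The index `i : Fin (2N - 1)`
stands for the node `x_{i+1}`. -/
def stiffness (a b α r : ℝ) (N : ℕ) : Matrix (Fin (2 * N - 1)) (Fin (2 * N - 1)) ℝ :=
  Matrix.of fun i k => coeff a b α r N (i + 1) (k + 1)

/-- The load vector at time `t`, with entries `f(x_i, t)`. -/
def load (a b r : ℝ) (f : ℝ → ℝ → ℝ) (N : ℕ) (t : ℝ) : Fin (2 * N - 1) → ℝ :=
  fun i => f (node a b r N (i + 1)) t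

/-- `U 0, …, U M` is computed by the Crank–Nicolson collocation scheme with step `τ = 1 / M`:
`(I + τ/2 A) U^j = (I - τ/2 A) U^{j-1} + τ F^{j-1/2}` for `1 ≤ j ≤ M`, and `U^0` is the vector of
nodal values of `u₀`. -/
def IsSchemeSolution (a b α r : ℝ) (u₀ : ℝ → ℝ) (f : ℝ → ℝ → ℝ) (N M : ℕ)
    (U : ℕ → Fin (2 * N - 1) → ℝ) : Prop :=
  (∀ i, U 0 i = u₀ (node a b r N (i + 1))) ∧
  ∀ j : ℕ, 1 ≤ j → j ≤ M →
    (1 + (1 / (M : ℝ) / 2) • stiffness a b α r N).mulVec (U j) =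
      (1 - (1 / (M : ℝ) / 2) • stiffness a b α r N).mulVec (U (j - 1)) +
        (1 / (M : ℝ)) • load a b r f N (((j : ℝ) - 1 / 2) * (1 / (M : ℝ)))

end

end NonlocalCN

/-
Put `β = r (1 + σ - α)`. For a fixed time, the collocation matrix acts on nodal values of `u` like
`-𝓛 u` up to the integral of the interpolation error against the kernel. Cells at distance `X` from
the boundary have width of order `N⁻¹ X^(1 - 1/r)`, so that error is of order `N^(-2) X^(σ - 2/r)`,
and the integral of `X^(σ - 2/r)` times the kernel, cut off at the first cell, leads to `N^(-β)`,
`N^(-2) log N` or `N^(-2)` according to the sign of `β - 2`. In time the scheme is a midpoint rule,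
consistent to second order since `u_tt` is controlled by `u` and `u_ttt`.

The matrix `A` is weakly diagonally dominant by rows, with diagonal bounded by
`D = 2 / (1 - α) (b - a)^(1 - α)`, uniformly in the mesh, because the kernel is integrable. Hence
`I + τ/2 A` is expansive in the maximum norm while `I - τ/2 A` has norm at most `1 + τ D`, and
errors grow by at most `exp D` up to time one.
-/

namespace NonlocalCN

open Set MeasureTheory

/-! ### The singular kernel -/

theorem rpow_le_add_rpow {c d y : ℝ} (hc : 0 < c) (hy : y ∈ Icc c d) (p : ℝ) :
    y ^ p ≤ c ^ p + d ^ p := by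
  have hy₀ : 0 < y := hc.trans_le hy.1
  rcases le_total 0 p with hp | hp
  · exact (Real.rpow_le_rpow hy₀.le hy.2 hp).trans (le_add_of_nonneg_left (by positivity))
  · have hd : 0 ≤ d := hy₀.le.trans hy.2
    exact (Real.rpow_le_rpow_of_nonpos hc hy.1 hp).trans (le_add_of_nonneg_right (by positivity))

theorem rpow_le_rpow_abs_mul_rpow {κ x y : ℝ} (p : ℝ) (hx : 0 < x) (hy : 0 < y)
    (hxy : x ≤ κ * y) (hyx : y ≤ κ * x) : x ^ p ≤ κ ^ |p| * y ^ p := by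
  have hκ : 0 < κ := pos_of_mul_pos_left (hx.trans_le hxy) hy.le
  rcases le_total 0 p with hp | hp
  · rw [abs_of_nonneg hp, ← Real.mul_rpow hκ.le hy.le]
    exact Real.rpow_le_rpow hx.le hxy hp
  · rw [abs_of_nonpos hp, Real.rpow_neg hκ.le, ← Real.inv_rpow hκ.le,
      ← Real.mul_rpow (inv_nonneg.2 hκ.le) hy.le]
    exact Real.rpow_le_rpow_of_nonpos (by positivity) ((inv_mul_le_iff₀ hκ).2 hyx) hp

theorem intervalIntegrable_abs_rpow {s : ℝ} (hs : -1 < s) (c d : ℝ) :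
    IntervalIntegrable (fun y : ℝ => |y| ^ s) volume c d := by
  have of_nonneg : ∀ e : ℝ, 0 ≤ e → IntervalIntegrable (fun y : ℝ => |y| ^ s) volume 0 e := by
    intro e he
    refine (intervalIntegral.intervalIntegrable_rpow' hs (a := 0) (b := e)).congr fun y hy => ?_
    rw [uIoc_of_le he] at hy
    simp only [abs_of_pos hy.1]
  have from_zero : ∀ e : ℝ, IntervalIntegrable (fun y : ℝ => |y| ^ s) volume 0 e := by
    intro e
    rcases le_total 0 e with he | he
    · exact of_nonneg e he
    · simpa using (of_nonneg (-e) (neg_nonneg.2 he)).comp_sub_left 0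
  exact (from_zero c).symm.trans (from_zero d)

theorem intervalIntegrable_kernel {α : ℝ} (hα : α < 1) (x c d : ℝ) :
    IntervalIntegrable (fun y : ℝ => |x - y| ^ (-α)) volume c d := by
  simpa using (intervalIntegrable_abs_rpow (s := -α) (by linarith) (x - c) (x - d)).comp_sub_left x

theorem integral_abs_rpow {s h : ℝ} (hs : -1 < s) (hh : 0 ≤ h) :
    ∫ y in (0 : ℝ)..h, |y| ^ s = h ^ (s + 1) / (s + 1) := by
  have drop_abs : ∫ y in (0 : ℝ)..h, |y| ^ s = ∫ y in (0 : ℝ)..h, y ^ s := by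
    refine intervalIntegral.integral_congr fun y hy => ?_
    rw [uIcc_of_le hh] at hy
    simp only [abs_of_nonneg hy.1]
  rw [drop_abs, integral_rpow (Or.inl hs), Real.zero_rpow (by linarith), sub_zero]

theorem integral_kernel_le_of_mem {α x c d : ℝ} (hα : α < 1) (hx : x ∈ Icc c d) :
    ∫ y in c..d, |x - y| ^ (-α) ≤ 2 / (1 - α) * (d - c) ^ (1 - α) := by
  have left : ∫ y in c..x, |x - y| ^ (-α) = (x - c) ^ (1 - α) / (1 - α) := by
    rw [intervalIntegral.integral_comp_sub_left (fun z => |z| ^ (-α)) x, sub_self,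
      integral_abs_rpow (by linarith) (sub_nonneg.2 hx.1), neg_add_eq_sub]
  have right : ∫ y in x..d, |x - y| ^ (-α) = (d - x) ^ (1 - α) / (1 - α) := by
    simp_rw [abs_sub_comm x]
    rw [intervalIntegral.integral_comp_sub_right (fun z => |z| ^ (-α)) x, sub_self,
      integral_abs_rpow (by linarith) (sub_nonneg.2 hx.2), neg_add_eq_sub]
  have : 0 < 1 - α := sub_pos.2 hα
  calc ∫ y in c..d, |x - y| ^ (-α)
      = (x - c) ^ (1 - α) / (1 - α) + (d - x) ^ (1 - α) / (1 - α) := by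
        rw [← intervalIntegral.integral_add_adjacent_intervals
          (intervalIntegrable_kernel hα x c x) (intervalIntegrable_kernel hα x x d), left, right]
    _ ≤ (d - c) ^ (1 - α) / (1 - α) + (d - c) ^ (1 - α) / (1 - α) := by
        have hcx := sub_nonneg.2 hx.1
        have hxd := sub_nonneg.2 hx.2
        gcongr
        exacts [hx.2, hx.1]
    _ = 2 / (1 - α) * (d - c) ^ (1 - α) := by ring

theorem integral_kernel_le {α c d : ℝ} (hα₀ : 0 ≤ α) (hα : α < 1) (x : ℝ) (hcd : c ≤ d) :
    ∫ y in c..d, |x - y| ^ (-α) ≤ 2 / (1 - α) * (d - c) ^ (1 - α) := by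
  -- Replacing `x` by the point of `[c, d]` nearest to it makes the kernel larger.
  set x' : ℝ := ↑(projIcc c d hcd x)
  refine le_trans ?_ (integral_kernel_le_of_mem hα (projIcc c d hcd x).2)
  refine intervalIntegral.integral_mono_ae_restrict hcd (intervalIntegrable_kernel hα x c d)
    (intervalIntegrable_kernel hα x' c d) ?_
  have hne : ∀ᵐ y ∂(volume.restrict (Icc c d)), y ≠ x' :=
    ae_restrict_of_ae (Measure.ae_ne volume x')
  filter_upwards [hne, ae_restrict_mem measurableSet_Icc] with y hy hyI
  refine Real.rpow_le_rpow_of_nonpos (abs_pos.2 (sub_ne_zero.2 hy.symm)) ?_ (neg_nonpos.2 hα₀)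
  simpa only [projIcc_of_mem hcd hyI] using abs_projIcc_sub_projIcc hcd (c := x) (d := y)

theorem intervalIntegrable_mul_kernel {α c d B : ℝ} {E : ℝ → ℝ} (hα : α < 1) (x : ℝ) (hcd : c ≤ d)
    (hE : AEStronglyMeasurable E (volume.restrict (Ioc c d)))
    (hB : ∀ y ∈ Ioc c d, |E y| ≤ B) :
    IntervalIntegrable (fun y => E y * |x - y| ^ (-α)) volume c d := by
  have hk := intervalIntegrable_kernel hα x c d
  rw [intervalIntegrable_iff_integrableOn_Ioc_of_le hcd] at hk ⊢
  exact Integrable.bdd_mul (c := B) hk hE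
    ((ae_restrict_iff' measurableSet_Ioc).2 (Filter.Eventually.of_forall hB))

theorem abs_integral_le_integral_of_abs_le {f g : ℝ → ℝ} {c d : ℝ} (hcd : c ≤ d)
    (hfg : ∀ y ∈ Ioc c d, |f y| ≤ g y) (hg : IntervalIntegrable g volume c d) :
    |∫ y in c..d, f y| ≤ ∫ y in c..d, g y := by
  rw [← Real.norm_eq_abs]
  exact intervalIntegral.norm_integral_le_of_norm_le hcd (Filter.Eventually.of_forall hfg) hg

theorem abs_integral_mul_kernel_le {α c d B : ℝ} {E : ℝ → ℝ} (hα₀ : 0 ≤ α) (hα : α < 1) (x : ℝ)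
    (hcd : c ≤ d) (hB₀ : 0 ≤ B) (hB : ∀ y ∈ Ioc c d, |E y| ≤ B) :
    |∫ y in c..d, E y * |x - y| ^ (-α)| ≤ B * (2 / (1 - α) * (d - c) ^ (1 - α)) := by
  calc |∫ y in c..d, E y * |x - y| ^ (-α)|
      ≤ ∫ y in c..d, B * |x - y| ^ (-α) := by
        refine abs_integral_le_integral_of_abs_le hcd (fun y hy => ?_)
          ((intervalIntegrable_kernel hα x c d).const_mul B)
        rw [abs_mul, abs_of_nonneg (Real.rpow_nonneg (abs_nonneg (x - y)) _)]
        exact mul_le_mul_of_nonneg_right (hB y hy) (Real.rpow_nonneg (abs_nonneg _) _)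
    _ ≤ B * (2 / (1 - α) * (d - c) ^ (1 - α)) := by
        rw [intervalIntegral.integral_const_mul]
        exact mul_le_mul_of_nonneg_left (integral_kernel_le hα₀ hα x hcd) hB₀

theorem integrable_indicator_kernel {α : ℝ} (hα : α < 1) (x c d : ℝ) :
    Integrable ((Ioc c d).indicator fun y : ℝ => |x - y| ^ (-α)) :=
  (integrable_indicator_iff measurableSet_Ioc).2 (intervalIntegrable_kernel hα x c d).1

theorem integral_indicator_kernel_le {α c d z L : ℝ} (hα₀ : 0 ≤ α) (hα : α < 1) (x : ℝ)
    (hcd : c ≤ d) (hzL : z ≤ L) :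
    ∫ y in z..L, (Ioc c d).indicator (fun y : ℝ => |x - y| ^ (-α)) y ≤
      2 / (1 - α) * (d - c) ^ (1 - α) := by
  rw [intervalIntegral.integral_of_le hzL]
  calc ∫ y in Ioc z L, (Ioc c d).indicator (fun y : ℝ => |x - y| ^ (-α)) y
      ≤ ∫ y, (Ioc c d).indicator (fun y : ℝ => |x - y| ^ (-α)) y :=
        setIntegral_le_integral (integrable_indicator_kernel hα x c d)
          (Filter.Eventually.of_forall <|
            indicator_nonneg fun _ _ => Real.rpow_nonneg (abs_nonneg _) _)
    _ = ∫ y in c..d, |x - y| ^ (-α) := by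
        rw [integral_indicator measurableSet_Ioc, intervalIntegral.integral_of_le hcd]
    _ ≤ 2 / (1 - α) * (d - c) ^ (1 - α) := integral_kernel_le hα₀ hα x hcd

theorem rpow_mul_kernel_le {α X y : ℝ} (p : ℝ) (hα₀ : 0 ≤ α) (hX : 0 < X) (hy : 0 < y) :
    y ^ p * |X - y| ^ (-α) ≤ 2 ^ α * y ^ (p - α) +
      2 ^ |p| * X ^ p * (Ioc (X / 2) (2 * X)).indicator (fun y => |X - y| ^ (-α)) y := by
  have hk : 0 ≤ |X - y| ^ (-α) := Real.rpow_nonneg (abs_nonneg _) _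
  rcases le_or_gt (y / 2) |X - y| with far | near
  · have hind := indicator_nonneg (s := Ioc (X / 2) (2 * X)) (f := fun y => |X - y| ^ (-α))
      (fun _ _ => Real.rpow_nonneg (abs_nonneg _) _) y
    refine le_add_of_le_of_nonneg ?_ (by positivity)
    calc y ^ p * |X - y| ^ (-α) ≤ y ^ p * (y / 2) ^ (-α) := by
          gcongr ?_ * ?_
          exact Real.rpow_le_rpow_of_nonpos (by positivity) far (by linarith)
      _ = 2 ^ α * y ^ (p - α) := by
          rw [Real.div_rpow hy.le zero_le_two, Real.rpow_neg zero_le_two, sub_eq_add_neg,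
            Real.rpow_add hy]
          field_simp
  · rw [abs_lt] at near
    have hmem : y ∈ Ioc (X / 2) (2 * X) := ⟨by linarith, by linarith⟩
    rw [indicator_of_mem hmem]
    refine le_add_of_nonneg_of_le (by positivity) (mul_le_mul_of_nonneg_right ?_ hk)
    exact rpow_le_rpow_abs_mul_rpow p hy hX hmem.2 (by linarith)

theorem abs_integral_mul_kernel_le_of_le_rpow {α p z L X B : ℝ} {E : ℝ → ℝ} (hα₀ : 0 ≤ α)
    (hα : α < 1) (hz : 0 < z) (hzL : z ≤ L) (hX : 0 < X) (hB₀ : 0 ≤ B)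
    (hB : ∀ y ∈ Ioc z L, |E y| ≤ B * y ^ p) :
    |∫ y in z..L, E y * |X - y| ^ (-α)| ≤
      B * (2 ^ α * (∫ y in z..L, y ^ (p - α)) +
        2 ^ |p| * (2 / (1 - α) * 2 ^ (1 - α)) * X ^ (p + 1 - α)) := by
  set near : ℝ → ℝ := (Ioc (X / 2) (2 * X)).indicator fun y => |X - y| ^ (-α)
  have hpow : IntervalIntegrable (fun y : ℝ => y ^ (p - α)) volume z L :=
    intervalIntegral.intervalIntegrable_rpow (Or.inr (notMem_uIcc_of_lt hz (hz.trans_le hzL)))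
  have hnear : IntervalIntegrable near volume z L :=
    (integrable_indicator_kernel hα X _ _).intervalIntegrable
  have hle : ∀ y ∈ Ioc z L, |E y * |X - y| ^ (-α)| ≤
      B * (2 ^ α * y ^ (p - α) + 2 ^ |p| * X ^ p * near y) := by
    intro y hy
    have hk : 0 ≤ |X - y| ^ (-α) := Real.rpow_nonneg (abs_nonneg _) _
    rw [abs_mul, abs_of_nonneg hk]
    calc |E y| * |X - y| ^ (-α) ≤ B * y ^ p * |X - y| ^ (-α) := by gcongr; exact hB y hy
      _ = B * (y ^ p * |X - y| ^ (-α)) := mul_assoc _ _ _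
      _ ≤ _ := mul_le_mul_of_nonneg_left (rpow_mul_kernel_le p hα₀ hX (hz.trans hy.1)) hB₀
  calc |∫ y in z..L, E y * |X - y| ^ (-α)|
      ≤ ∫ y in z..L, B * (2 ^ α * y ^ (p - α) + 2 ^ |p| * X ^ p * near y) :=
        abs_integral_le_integral_of_abs_le hzL hle
          (((hpow.const_mul _).add (hnear.const_mul _)).const_mul _)
    _ = B * (2 ^ α * (∫ y in z..L, y ^ (p - α)) + 2 ^ |p| * X ^ p * ∫ y in z..L, near y) := by
        rw [intervalIntegral.integral_const_mul,
          intervalIntegral.integral_add (hpow.const_mul _) (hnear.const_mul _),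
          intervalIntegral.integral_const_mul, intervalIntegral.integral_const_mul]
    _ ≤ B * (2 ^ α * (∫ y in z..L, y ^ (p - α)) +
          2 ^ |p| * X ^ p * (2 / (1 - α) * (2 * X) ^ (1 - α))) := by
        gcongr
        refine (integral_indicator_kernel_le hα₀ hα X (by linarith) hzL).trans ?_
        have : 0 < 1 - α := sub_pos.2 hα
        gcongr <;> linarith
    _ = _ := by
        rw [Real.mul_rpow zero_le_two hX.le, add_sub_assoc p, Real.rpow_add hX]
        ring

/-! ### Graded meshes -/

/-- The nodes of the mesh on `[0, L]` graded towards the origin with exponent `r`; the left half of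
the mesh `node` is a translate of it. -/
noncomputable def gradedNode (L r : ℝ) (N j : ℕ) : ℝ := L * ((j : ℝ) / (N : ℝ)) ^ r

/-- The order of convergence in the number of cells: `N ^ (-min β 2)`, with an additional factor
`log N` in the critical case `β = 2`. -/
noncomputable def gradedRate (β : ℝ) (N : ℕ) : ℝ :=
  (N : ℝ) ^ (-min β 2) * if β = 2 then Real.log N else 1

section GradedMesh

variable {L r : ℝ} {N : ℕ}

theorem gradedNode_zero (hr : 0 < r) : gradedNode L r N 0 = 0 := by
  simp [gradedNode, Real.zero_rpow hr.ne']

theorem gradedNode_self (hN : 1 ≤ N) : gradedNode L r N N = L := by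
  have : (N : ℝ) ≠ 0 := by positivity
  simp [gradedNode, div_self this]

theorem gradedNode_strictMono (hL : 0 < L) (hr : 0 < r) (hN : 1 ≤ N) :
    StrictMono (gradedNode L r N) := fun i j hij => by
  have : (0 : ℝ) < N := by positivity
  unfold gradedNode
  gcongr

theorem gradedNode_pos (hL : 0 < L) {j : ℕ} (hN : 1 ≤ N) (hj : 1 ≤ j) :
    0 < gradedNode L r N j := by
  have : (0 : ℝ) < N := by positivity
  have : (0 : ℝ) < j := by positivity
  unfold gradedNode
  positivity

theorem gradedNode_one_le (hL : 0 < L) (hr : 0 < r) (hN : 1 ≤ N) : gradedNode L r N 1 ≤ L :=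
  ((gradedNode_strictMono hL hr hN).monotone hN).trans_eq (gradedNode_self hN)

theorem gradedNode_one_rpow (hL : 0 < L) (s : ℝ) :
    gradedNode L r N 1 ^ s = L ^ s * (N : ℝ) ^ (-(r * s)) := by
  rw [gradedNode, Nat.cast_one, one_div, Real.mul_rpow hL.le (by positivity),
    ← Real.rpow_mul (by positivity), Real.inv_rpow (by positivity), Real.rpow_neg (by positivity)]

theorem gradedNode_succ_le (hL : 0 < L) (hr : 0 < r) {j : ℕ} (hj : 1 ≤ j) :
    gradedNode L r N (j + 1) ≤ 2 ^ r * gradedNode L r N j := by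
  have hj' : (1 : ℝ) ≤ j := by exact_mod_cast hj
  calc gradedNode L r N (j + 1) ≤ L * (2 * ((j : ℝ) / N)) ^ r := by
        unfold gradedNode
        gcongr
        rw [Nat.cast_add_one, ← mul_div_assoc]
        gcongr
        linarith
    _ = 2 ^ r * gradedNode L r N j := by
        rw [Real.mul_rpow zero_le_two (by positivity), gradedNode]
        ring

theorem gradedNode_succ_sub_le (hL : 0 < L) (hr : 0 < r) (hN : 1 ≤ N) {j : ℕ} (hj : 1 ≤ j) {y : ℝ}
    (hy : y ∈ Icc (gradedNode L r N j) (gradedNode L r N (j + 1))) :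
    gradedNode L r N (j + 1) - gradedNode L r N j ≤
      r * 2 ^ |r - 1| * L ^ (1 / r) * ((N : ℝ)⁻¹ * y ^ (1 - 1 / r)) := by
  have hN₀ : (0 : ℝ) < N := by positivity
  have hj₁ : (1 : ℝ) ≤ j := by exact_mod_cast hj
  have hy₀ : 0 < y := (gradedNode_pos hL hN hj).trans_le hy.1
  set p : ℝ := (j : ℝ) / N
  set q : ℝ := ((j + 1 : ℕ) : ℝ) / N
  have hp : 0 < p := by positivity
  have hpq : q - p = (N : ℝ)⁻¹ := by simp only [p, q, Nat.cast_add_one]; field_simp; ring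
  have hq : q ≤ 2 * p := by
    simp only [p, q, Nat.cast_add_one, ← mul_div_assoc]; gcongr; linarith
  -- `s` is the parameter of `y`, that is `y = L * s ^ r`.
  set s : ℝ := (y / L) ^ r⁻¹
  have hps : p ≤ s := by
    rw [Real.le_rpow_inv_iff_of_pos hp.le (by positivity) hr, le_div_iff₀' hL]; exact hy.1
  have hsq : s ≤ q := by
    rw [Real.rpow_inv_le_iff_of_pos (by positivity) (by positivity) hr, div_le_iff₀' hL]
    exact hy.2
  obtain ⟨ξ, hξ, slope⟩ := exists_hasDerivAt_eq_slope (fun t => L * t ^ r)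
    (fun t => L * (r * t ^ (r - 1))) (show p < q by linarith [inv_pos.2 hN₀])
    (by fun_prop (disch := exact hr.le))
    (fun t ht => (Real.hasDerivAt_rpow_const (Or.inl (hp.trans ht.1).ne')).const_mul L)
  have hξs : ξ ^ (r - 1) ≤ 2 ^ |r - 1| * s ^ (r - 1) :=
    rpow_le_rpow_abs_mul_rpow _ (hp.trans hξ.1) (hp.trans_le hps)
      (by linarith [hξ.2]) (by linarith [hξ.1])
  calc gradedNode L r N (j + 1) - gradedNode L r N j
      = L * r * ξ ^ (r - 1) * (N : ℝ)⁻¹ := by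
        rw [eq_div_iff (by rw [hpq]; positivity), hpq] at slope
        rw [mul_assoc L r, slope]; rfl
    _ ≤ L * r * (2 ^ |r - 1| * s ^ (r - 1)) * (N : ℝ)⁻¹ := by gcongr
    _ = r * 2 ^ |r - 1| * L ^ (1 / r) * ((N : ℝ)⁻¹ * y ^ (1 - 1 / r)) := by
        have hexp : r⁻¹ * (r - 1) = 1 - 1 / r := by field_simp
        have hLr : L / L ^ (1 - 1 / r) = L ^ (1 / r) := by
          conv_lhs => rw [← Real.rpow_one L, ← Real.rpow_mul hL.le, ← Real.rpow_sub hL]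
          congr 1; ring
        rw [← Real.rpow_mul (by positivity), hexp, Real.div_rpow hy₀.le hL.le, ← hLr]
        ring

theorem gradedRate_nonneg (β : ℝ) (N : ℕ) : 0 ≤ gradedRate β N := by
  have := Real.log_natCast_nonneg N
  unfold gradedRate
  split_ifs <;> positivity

theorem rpow_neg_min_le_gradedRate {β : ℝ} (hN₂ : β = 2 → 2 ≤ N) :
    (N : ℝ) ^ (-min β 2) ≤ (Real.log 2)⁻¹ * gradedRate β N := by
  have hlog : 0 < Real.log 2 := Real.log_pos one_lt_two
  have hfac : Real.log 2 ≤ if β = 2 then Real.log N else 1 := by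
    split_ifs with hβ
    · exact Real.log_le_log zero_lt_two (by exact_mod_cast hN₂ hβ)
    · linarith [Real.log_two_lt_d9]
  rw [gradedRate, ← div_eq_inv_mul, le_div_iff₀ hlog]
  gcongr

theorem natCast_rpow_neg_le_gradedRate {β γ : ℝ} (hN : 1 ≤ N) (hN₂ : β = 2 → 2 ≤ N)
    (hγ : min β 2 ≤ γ) : (N : ℝ) ^ (-γ) ≤ (Real.log 2)⁻¹ * gradedRate β N :=
  (Real.rpow_le_rpow_of_exponent_le (by exact_mod_cast hN) (neg_le_neg hγ)).trans
    (rpow_neg_min_le_gradedRate hN₂)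

theorem gradedNode_one_rpow_le (hL : 0 < L) (s : ℝ) (hN : 1 ≤ N) (hN₂ : r * s = 2 → 2 ≤ N) :
    gradedNode L r N 1 ^ s ≤ L ^ s * (Real.log 2)⁻¹ * gradedRate (r * s) N := by
  rw [gradedNode_one_rpow hL, mul_assoc]
  gcongr
  exact natCast_rpow_neg_le_gradedRate hN hN₂ (min_le_left _ _)

theorem rpow_neg_two_mul_gradedNode_one_rpow_le (hL : 0 < L) (q : ℝ) (hN : 1 ≤ N)
    (hN₂ : r * q + 2 = 2 → 2 ≤ N) :
    (N : ℝ) ^ (-2 : ℝ) * gradedNode L r N 1 ^ q ≤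
      L ^ q * (Real.log 2)⁻¹ * gradedRate (r * q + 2) N := by
  have hN₀ : (0 : ℝ) < N := by positivity
  calc (N : ℝ) ^ (-2 : ℝ) * gradedNode L r N 1 ^ q = L ^ q * (N : ℝ) ^ (-(r * q + 2)) := by
        rw [gradedNode_one_rpow hL, neg_add, Real.rpow_add hN₀]
        ring
    _ ≤ L ^ q * ((Real.log 2)⁻¹ * gradedRate (r * q + 2) N) := by
        gcongr
        exact natCast_rpow_neg_le_gradedRate hN hN₂ (min_le_left _ _)
    _ = _ := (mul_assoc _ _ _).symm

theorem rpow_neg_two_mul_rpow_le (hL : 0 < L) (q : ℝ) (hN : 1 ≤ N) (hN₂ : r * q + 2 = 2 → 2 ≤ N)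
    {W X : ℝ} (hX : X ∈ Icc (gradedNode L r N 1) W) :
    (N : ℝ) ^ (-2 : ℝ) * X ^ q ≤
      (L ^ q + W ^ q) * (Real.log 2)⁻¹ * gradedRate (r * q + 2) N := by
  have hz : 0 < gradedNode L r N 1 := gradedNode_pos hL hN le_rfl
  have hW : 0 < W := hz.trans_le (hX.1.trans hX.2)
  calc (N : ℝ) ^ (-2 : ℝ) * X ^ q
      ≤ (N : ℝ) ^ (-2 : ℝ) * (gradedNode L r N 1 ^ q + W ^ q) := by
        gcongr; exact rpow_le_add_rpow hz hX q
    _ = (N : ℝ) ^ (-2 : ℝ) * gradedNode L r N 1 ^ q + W ^ q * (N : ℝ) ^ (-2 : ℝ) := by ring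
    _ ≤ L ^ q * (Real.log 2)⁻¹ * gradedRate (r * q + 2) N +
          W ^ q * ((Real.log 2)⁻¹ * gradedRate (r * q + 2) N) := by
        gcongr ?_ + _ * ?_
        · exact rpow_neg_two_mul_gradedNode_one_rpow_le hL q hN hN₂
        · exact natCast_rpow_neg_le_gradedRate hN hN₂ (min_le_right _ _)
    _ = _ := by ring

theorem integral_rpow_sub_one_le {q z L : ℝ} (hq : q ≠ 0) (hz : 0 < z) (hL : 0 < L) :
    ∫ y in z..L, y ^ (q - 1) ≤ (z ^ q + L ^ q) / |q| := by
  rw [integral_rpow (Or.inr ⟨fun h => hq (by linarith), notMem_uIcc_of_lt hz hL⟩), sub_add_cancel]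
  refine (le_abs_self _).trans ?_
  rw [abs_div]
  gcongr
  refine (abs_sub _ _).trans_eq ?_
  rw [abs_of_pos (by positivity), abs_of_pos (by positivity), add_comm]

theorem integral_inv_gradedNode_one (hL : 0 < L) (hN : 1 ≤ N) :
    ∫ y in gradedNode L r N 1..L, y⁻¹ = r * Real.log N := by
  have : (0 : ℝ) < N := by positivity
  rw [integral_inv_of_pos (gradedNode_pos hL hN le_rfl) hL, gradedNode, Nat.cast_one, one_div,
    Real.log_div hL.ne' (by positivity), Real.log_mul hL.ne' (by positivity),
    Real.log_rpow (by positivity), Real.log_inv]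
  ring

theorem exists_bound_integral_rpow (hL : 0 < L) (hr : 0 < r) (q : ℝ) :
    ∃ C, 0 ≤ C ∧ ∀ N : ℕ, 1 ≤ N → (r * q + 2 = 2 → 2 ≤ N) →
      (N : ℝ) ^ (-2 : ℝ) * ∫ y in gradedNode L r N 1..L, y ^ (q - 1) ≤
        C * gradedRate (r * q + 2) N := by
  rcases eq_or_ne q 0 with rfl | hq
  · refine ⟨r, hr.le, fun N hN _ => le_of_eq ?_⟩
    simp only [zero_sub, Real.rpow_neg_one, integral_inv_gradedNode_one hL hN, gradedRate,
      mul_zero, zero_add, min_self, if_true]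
    ring
  · refine ⟨(L ^ q + L ^ q) * (Real.log 2)⁻¹ / |q|, by positivity, fun N hN hN₂ => ?_⟩
    have hz : 0 < gradedNode L r N 1 := gradedNode_pos hL hN le_rfl
    calc (N : ℝ) ^ (-2 : ℝ) * ∫ y in gradedNode L r N 1..L, y ^ (q - 1)
        ≤ (N : ℝ) ^ (-2 : ℝ) * ((gradedNode L r N 1 ^ q + L ^ q) / |q|) := by
          gcongr; exact integral_rpow_sub_one_le hq hz hL
      _ = ((N : ℝ) ^ (-2 : ℝ) * gradedNode L r N 1 ^ q + L ^ q * (N : ℝ) ^ (-2 : ℝ)) / |q| := by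
          ring
      _ ≤ (L ^ q * (Real.log 2)⁻¹ * gradedRate (r * q + 2) N +
            L ^ q * ((Real.log 2)⁻¹ * gradedRate (r * q + 2) N)) / |q| := by
          gcongr (?_ + _ * ?_) / _
          · exact rpow_neg_two_mul_gradedNode_one_rpow_le hL q hN hN₂
          · exact natCast_rpow_neg_le_gradedRate hN hN₂ (min_le_right _ _)
      _ = _ := by ring

theorem abs_integral_mul_kernel_first_cell_le {σ α B : ℝ} {E : ℝ → ℝ} (hL : 0 < L)
    (hα₀ : 0 ≤ α) (hα₁ : α < 1) (X : ℝ) (hN : 1 ≤ N) (hN₂ : r * (1 + σ - α) = 2 → 2 ≤ N)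
    (hB : 0 ≤ B) (hE : ∀ y ∈ Ioc 0 (gradedNode L r N 1), |E y| ≤ B * gradedNode L r N 1 ^ σ) :
    |∫ y in (0 : ℝ)..gradedNode L r N 1, E y * |X - y| ^ (-α)| ≤
      B * (2 / (1 - α) * (L ^ (1 + σ - α) * (Real.log 2)⁻¹)) *
        gradedRate (r * (1 + σ - α)) N := by
  have hz : 0 < gradedNode L r N 1 := gradedNode_pos hL hN le_rfl
  have : 0 < 1 - α := sub_pos.2 hα₁
  calc |∫ y in (0 : ℝ)..gradedNode L r N 1, E y * |X - y| ^ (-α)|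
      ≤ B * gradedNode L r N 1 ^ σ * (2 / (1 - α) * (gradedNode L r N 1 - 0) ^ (1 - α)) :=
        abs_integral_mul_kernel_le hα₀ hα₁ X hz.le (by positivity) hE
    _ = B * (2 / (1 - α) * gradedNode L r N 1 ^ (1 + σ - α)) := by
        rw [sub_zero, show 1 + σ - α = σ + (1 - α) by ring, Real.rpow_add hz]; ring
    _ ≤ B * (2 / (1 - α) *
          (L ^ (1 + σ - α) * (Real.log 2)⁻¹ * gradedRate (r * (1 + σ - α)) N)) := by
        gcongr; exact gradedNode_one_rpow_le hL _ hN hN₂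
    _ = _ := by ring

theorem exists_bound_integral_mul_kernel_inner_cells {α : ℝ} (hL : 0 < L) (hr : 0 < r)
    (hα₀ : 0 ≤ α) (hα₁ : α < 1) (p : ℝ) :
    ∃ C, 0 ≤ C ∧ ∀ (N : ℕ) (B X : ℝ) (E : ℝ → ℝ), 1 ≤ N →
      (r * (p + 1 - α) + 2 = 2 → 2 ≤ N) → 0 ≤ B → X ∈ Icc (gradedNode L r N 1) (2 * L) →
      (∀ y ∈ Ioc (gradedNode L r N 1) L, |E y| ≤ B * (N : ℝ) ^ (-2 : ℝ) * y ^ p) →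
      |∫ y in gradedNode L r N 1..L, E y * |X - y| ^ (-α)| ≤
        B * C * gradedRate (r * (p + 1 - α) + 2) N := by
  set q := p + 1 - α
  obtain ⟨Ci, hCi, hint⟩ := exists_bound_integral_rpow hL hr q
  have : 0 < 1 - α := sub_pos.2 hα₁
  set Cn := 2 ^ |p| * (2 / (1 - α) * 2 ^ (1 - α))
  set CX := (L ^ q + (2 * L) ^ q) * (Real.log 2)⁻¹
  refine ⟨2 ^ α * Ci + Cn * CX, by positivity, fun N B X E hN hN₂ hB hX hE => ?_⟩
  set z := gradedNode L r N 1
  set rate := gradedRate (r * q + 2) N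
  have hz : 0 < z := gradedNode_pos hL hN le_rfl
  calc |∫ y in z..L, E y * |X - y| ^ (-α)|
      ≤ B * (N : ℝ) ^ (-2 : ℝ) * (2 ^ α * (∫ y in z..L, y ^ (q - 1)) + Cn * X ^ q) := by
        rw [show q - 1 = p - α by ring]
        exact abs_integral_mul_kernel_le_of_le_rpow hα₀ hα₁ hz (gradedNode_one_le hL hr hN)
          (hz.trans_le hX.1) (by positivity) hE
    _ = B * (2 ^ α * ((N : ℝ) ^ (-2 : ℝ) * ∫ y in z..L, y ^ (q - 1)) +
          Cn * ((N : ℝ) ^ (-2 : ℝ) * X ^ q)) := by ring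
    _ ≤ B * (2 ^ α * (Ci * rate) + Cn * (CX * rate)) := by
        gcongr _ * (_ * ?_ + _ * ?_)
        · exact hint N hN hN₂
        · exact rpow_neg_two_mul_rpow_le hL q hN hN₂ hX
    _ = _ := by ring

theorem exists_bound_integral_mul_kernel_graded {σ α : ℝ} (hL : 0 < L) (hr : 0 < r)
    (hα₀ : 0 ≤ α) (hα₁ : α < 1) :
    ∃ C, 0 ≤ C ∧ ∀ (N : ℕ) (B X : ℝ) (E : ℝ → ℝ), 1 ≤ N → (r * (1 + σ - α) = 2 → 2 ≤ N) → 0 ≤ B →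
      X ∈ Icc (gradedNode L r N 1) (2 * L) →
      IntervalIntegrable (fun y => E y * |X - y| ^ (-α)) volume 0 L →
      (∀ y ∈ Ioc 0 (gradedNode L r N 1), |E y| ≤ B * gradedNode L r N 1 ^ σ) →
      (∀ y ∈ Ioc (gradedNode L r N 1) L, |E y| ≤ B * (N : ℝ) ^ (-2 : ℝ) * y ^ (σ - 2 / r)) →
      |∫ y in (0 : ℝ)..L, E y * |X - y| ^ (-α)| ≤ B * C * gradedRate (r * (1 + σ - α)) N := by
  have hexp : r * (σ - 2 / r + 1 - α) + 2 = r * (1 + σ - α) := by field_simp; ring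
  obtain ⟨C, hC, inner_cells⟩ :=
    exists_bound_integral_mul_kernel_inner_cells hL hr hα₀ hα₁ (σ - 2 / r)
  rw [hexp] at inner_cells
  have : 0 < 1 - α := sub_pos.2 hα₁
  refine ⟨2 / (1 - α) * (L ^ (1 + σ - α) * (Real.log 2)⁻¹) + C, by positivity,
    fun N B X E hN hN₂ hB hX hE hfirst hinner => ?_⟩
  have hz : gradedNode L r N 1 ∈ uIcc 0 L := by
    rw [uIcc_of_le hL.le]
    exact ⟨(gradedNode_pos hL hN le_rfl).le, gradedNode_one_le hL hr hN⟩
  rw [← intervalIntegral.integral_add_adjacent_intervals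
    (hE.mono_set (uIcc_subset_uIcc_left hz)) (hE.mono_set (uIcc_subset_uIcc_right hz))]
  refine (abs_add_le _ _).trans ((add_le_add
    (abs_integral_mul_kernel_first_cell_le hL hα₀ hα₁ X hN hN₂ hB hfirst)
    (inner_cells N B X E hN hN₂ hB hX hinner)).trans_eq ?_)
  ring

end GradedMesh

/-! ### Piecewise linear interpolation -/

section Node

variable {a b r : ℝ} {N : ℕ}

theorem node_of_le {j : ℕ} (hj : j ≤ N) :
    node a b r N j = a + gradedNode ((b - a) / 2) r N j := by
  rw [node, if_pos hj, gradedNode]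

theorem node_of_ge (hN : 1 ≤ N) {j : ℕ} (hNj : N ≤ j) (hj : j ≤ 2 * N) :
    node a b r N j = b - gradedNode ((b - a) / 2) r N (2 * N - j) := by
  have hN₀ : (N : ℝ) ≠ 0 := by positivity
  rcases hNj.eq_or_lt with rfl | hNj
  · rw [node_of_le le_rfl, show 2 * N - N = N by omega, gradedNode_self hN]
    ring
  · have hcast : ((2 * N - j : ℕ) : ℝ) / N = 2 - (j : ℝ) / N := by
      rw [Nat.cast_sub hj]; push_cast; field_simp
    rw [node, if_neg hNj.not_ge, gradedNode, hcast]

theorem node_two_mul_sub (hN : 1 ≤ N) {j : ℕ} (hj : j ≤ 2 * N) :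
    node a b r N (2 * N - j) = a + b - node a b r N j := by
  rcases le_total j N with h | h
  · rw [node_of_ge hN (by omega) (by omega), node_of_le h, Nat.sub_sub_self hj]
    ring
  · rw [node_of_le (by omega), node_of_ge hN h hj]
    ring

theorem node_zero (hr : 0 < r) : node a b r N 0 = a := by
  rw [node_of_le (Nat.zero_le _), gradedNode_zero hr, add_zero]

theorem node_last (hr : 0 < r) (hN : 1 ≤ N) : node a b r N (2 * N) = b := by
  rw [node_of_ge hN (by omega) le_rfl, Nat.sub_self, gradedNode_zero hr, sub_zero]

theorem node_strictMonoOn (hab : a < b) (hr : 0 < r) (hN : 1 ≤ N) :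
    StrictMonoOn (node a b r N) (Iic (2 * N)) := by
  have hg := gradedNode_strictMono (half_pos (sub_pos.2 hab)) hr hN
  have left : StrictMonoOn (node a b r N) (Iic N) := fun i hi j hj hij => by
    rw [node_of_le hi, node_of_le hj]
    exact add_lt_add_right (hg hij) a
  have right : StrictMonoOn (node a b r N) (Icc N (2 * N)) := fun i hi j hj hij => by
    rw [node_of_ge hN hi.1 hi.2, node_of_ge hN hj.1 hj.2]
    exact sub_lt_sub_left (hg (by have := hj.2; omega)) b
  rw [← Iic_union_Icc_eq_Iic (show N ≤ 2 * N by omega)]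
  exact left.union right isGreatest_Iic (isLeast_Icc (by omega))

theorem node_mem_Ioo (hab : a < b) (hr : 0 < r) {i : ℕ} (hi : 0 < i) (hiN : i < 2 * N) :
    node a b r N i ∈ Ioo a b := by
  have hN : 1 ≤ N := by omega
  have hmono := node_strictMonoOn hab hr hN
  constructor
  · simpa only [node_zero hr] using hmono (mem_Iic.2 (Nat.zero_le _)) (mem_Iic.2 hiN.le) hi
  · simpa only [node_last hr hN] using hmono (mem_Iic.2 hiN.le) self_mem_Iic hiN

end Node

/-- The linear interpolant through `(c, v)` and `(d, w)`. -/
noncomputable def linInterp (c d v w y : ℝ) : ℝ :=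
  v * ((d - y) / (d - c)) + w * ((y - c) / (d - c))

theorem abs_linInterp_le {c d v w y B : ℝ} (hcd : c < d) (hy : y ∈ Icc c d) (hv : |v| ≤ B)
    (hw : |w| ≤ B) : |linInterp c d v w y| ≤ B := by
  have hdc : 0 < d - c := sub_pos.2 hcd
  have h₁ : 0 ≤ (d - y) / (d - c) := div_nonneg (sub_nonneg.2 hy.2) hdc.le
  have h₂ : 0 ≤ (y - c) / (d - c) := div_nonneg (sub_nonneg.2 hy.1) hdc.le
  calc |linInterp c d v w y| ≤ |v| * ((d - y) / (d - c)) + |w| * ((y - c) / (d - c)) := by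
        simpa only [linInterp, abs_mul, abs_of_nonneg h₁, abs_of_nonneg h₂] using
          abs_add_le (v * ((d - y) / (d - c))) (w * ((y - c) / (d - c)))
    _ ≤ B * ((d - y) / (d - c)) + B * ((y - c) / (d - c)) := by gcongr
    _ = B := by field_simp; ring

theorem linInterp_reflect (s c d v w y : ℝ) :
    linInterp (s - d) (s - c) w v (s - y) = linInterp c d v w y := by
  simp only [linInterp, sub_sub_sub_cancel_left]
  ring

theorem abs_sub_linInterp_le {G G' G'' : ℝ → ℝ} {c d y M : ℝ} (hcd : c < d)
    (hG : ∀ x ∈ Icc c d, HasDerivAt G (G' x) x) (hG' : ∀ x ∈ Icc c d, HasDerivAt G' (G'' x) x)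
    (hM : ∀ x ∈ Icc c d, |G'' x| ≤ M) (hy : y ∈ Icc c d) :
    |G y - linInterp c d (G c) (G d) y| ≤ M * (d - c) ^ 2 := by
  have hdc : 0 < d - c := sub_pos.2 hcd
  have hM₀ : 0 ≤ M := (abs_nonneg _).trans (hM y hy)
  rcases hy.1.eq_or_lt with rfl | hcy
  · have : G c - linInterp c d (G c) (G d) c = 0 := by unfold linInterp; field_simp; ring
    rw [this, abs_zero]
    positivity
  · have hyc : 0 < y - c := sub_pos.2 hcy
    have hcont : ∀ e ≤ d, ContinuousOn G (Icc c e) := fun e he x hx =>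
      (hG x ⟨hx.1, hx.2.trans he⟩).continuousAt.continuousWithinAt
    obtain ⟨ξ, hξ, slope_cd⟩ := exists_hasDerivAt_eq_slope G G' hcd (hcont d le_rfl)
      fun x hx => hG x (Ioo_subset_Icc_self hx)
    obtain ⟨η, hη, slope_cy⟩ := exists_hasDerivAt_eq_slope G G' hcy (hcont y hy.2)
      fun x hx => hG x ⟨hx.1.le, hx.2.le.trans hy.2⟩
    have hηξ : |η - ξ| ≤ d - c := by
      rw [abs_le]; constructor <;> linarith [hη.1, hη.2, hξ.1, hξ.2, hy.2]
    have hG'ηξ : |G' η - G' ξ| ≤ M * |η - ξ| :=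
      Convex.norm_image_sub_le_of_norm_hasDerivWithin_le
        (fun x hx => (hG' x hx).hasDerivWithinAt) hM (convex_Icc c d)
        (Ioo_subset_Icc_self hξ) ⟨hη.1.le, hη.2.le.trans hy.2⟩
    have herr : G y - linInterp c d (G c) (G d) y = (y - c) * (G' η - G' ξ) := by
      rw [slope_cd, slope_cy]; unfold linInterp; field_simp; ring
    calc |G y - linInterp c d (G c) (G d) y| = (y - c) * |G' η - G' ξ| := by
          rw [herr, abs_mul, abs_of_pos hyc]
      _ ≤ (d - c) * (M * (d - c)) := by
          gcongr
          · exact hy.2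
          · exact hG'ηξ.trans (by gcongr)
      _ = M * (d - c) ^ 2 := by ring

theorem exists_mem_Icc_succ {x : ℕ → ℝ} {m n : ℕ} {y : ℝ} (hmn : m < n)
    (hy : y ∈ Icc (x m) (x n)) : ∃ j ∈ Ico m n, y ∈ Icc (x j) (x (j + 1)) := by
  induction n, hmn using Nat.le_induction with
  | base => exact ⟨m, ⟨le_rfl, Nat.lt_succ_self m⟩, hy⟩
  | succ n hmn ih =>
    rcases le_total y (x n) with h | h
    · obtain ⟨j, hj, hyj⟩ := ih ⟨hy.1, h⟩
      exact ⟨j, ⟨hj.1, hj.2.trans (Nat.lt_succ_self n)⟩, hyj⟩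
    · exact ⟨n, ⟨(Nat.lt_of_succ_le hmn).le, Nat.lt_succ_self n⟩, h, hy.2⟩

section Hat

variable {x : ℕ → ℝ} {k : ℕ} {y : ℝ}

theorem hat_nonneg (x : ℕ → ℝ) (k : ℕ) (y : ℝ) : 0 ≤ hat x k y := by
  unfold hat
  split_ifs with h₁ h₂
  · exact div_nonneg (by linarith [h₁.1]) (by linarith [h₁.1, h₁.2])
  · exact div_nonneg (by linarith [h₂.2]) (by linarith [h₂.1, h₂.2])
  · exact le_rfl

theorem hat_le_one (x : ℕ → ℝ) (k : ℕ) (y : ℝ) : hat x k y ≤ 1 := by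
  unfold hat
  split_ifs with h₁ h₂
  · exact div_le_one_of_le₀ (by linarith [h₁.2]) (by linarith [h₁.1, h₁.2])
  · exact div_le_one_of_le₀ (by linarith [h₂.1]) (by linarith [h₂.1, h₂.2])
  · exact zero_le_one

theorem measurable_hat (x : ℕ → ℝ) (k : ℕ) : Measurable (hat x k) :=
  Measurable.ite measurableSet_Icc (by fun_prop)
    (Measurable.ite measurableSet_Icc (by fun_prop) measurable_const)

theorem hat_succ_of_mem_Icc (hy : y ∈ Icc (x k) (x (k + 1))) :
    hat x (k + 1) y = (y - x k) / (x (k + 1) - x k) :=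
  if_pos hy

theorem hat_of_mem_Icc (hk : x (k - 1) < x k) (hk' : x k < x (k + 1))
    (hy : y ∈ Icc (x k) (x (k + 1))) : hat x k y = (x (k + 1) - y) / (x (k + 1) - x k) := by
  unfold hat
  split_ifs with h
  · rw [le_antisymm h.2 hy.1, div_self (sub_pos.2 hk).ne', div_self (sub_pos.2 hk').ne']
  · rfl

theorem hat_eq_zero_of_le (hk : x (k - 1) < x k) (hy : y ≤ x (k - 1)) : hat x k y = 0 := by
  unfold hat
  split_ifs with h₁ h₂
  · rw [le_antisymm hy h₁.1, sub_self, zero_div]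
  · exact absurd (h₂.1.trans hy) hk.not_ge
  · rfl

theorem hat_eq_zero_of_ge (hk : x k < x (k + 1)) (hy : x (k + 1) ≤ y) : hat x k y = 0 := by
  unfold hat
  split_ifs with h₁ h₂
  · exact absurd (hy.trans h₁.2) hk.not_ge
  · rw [le_antisymm h₂.2 hy, sub_self, zero_div]
  · rfl

end Hat

/-- The piecewise linear function with values `w k` at the interior nodes `x k`, `0 < k < n`, and
value `0` at both end nodes. -/
noncomputable def interp (x : ℕ → ℝ) (n : ℕ) (w : ℕ → ℝ) (y : ℝ) : ℝ :=
  ∑ k : Fin (n - 1), w (k + 1) * hat x (k + 1) y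

/-- The error of piecewise linear interpolation of a function vanishing at both end nodes. -/
noncomputable def interpError (x : ℕ → ℝ) (n : ℕ) (v : ℝ → ℝ) (y : ℝ) : ℝ :=
  v y - interp x n (v ∘ x) y

section Interp

variable {x w : ℕ → ℝ} {n : ℕ}

theorem measurable_interp (x : ℕ → ℝ) (n : ℕ) (w : ℕ → ℝ) : Measurable (interp x n w) :=
  Finset.measurable_fun_sum _ fun _ _ => (measurable_hat x _).const_mul _

theorem interp_eq_sum_range (hn : 1 ≤ n) (hw₀ : w 0 = 0) (hwn : w n = 0) (y : ℝ) :
    interp x n w y = ∑ k ∈ Finset.range (n + 1), w k * hat x k y := by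
  obtain ⟨m, rfl⟩ := Nat.exists_eq_add_of_le' hn
  rw [Finset.sum_range_succ, hwn, zero_mul, add_zero, Finset.sum_range_succ', hw₀, zero_mul,
    add_zero]
  exact Fin.sum_univ_eq_sum_range (fun k => w (k + 1) * hat x (k + 1) y) m

theorem interp_eq_linInterp (hx : StrictMonoOn x (Iic n)) (hw₀ : w 0 = 0) (hwn : w n = 0)
    {j : ℕ} (hj : j < n) {y : ℝ} (hy : y ∈ Icc (x j) (x (j + 1))) :
    interp x n w y = linInterp (x j) (x (j + 1)) (w j) (w (j + 1)) y := by
  have lt : ∀ {i l}, i < l → l ≤ n → x i < x l := fun h hl =>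
    hx (mem_Iic.2 (h.le.trans hl)) (mem_Iic.2 hl) h
  have le : ∀ {i l}, i ≤ l → l ≤ n → x i ≤ x l := fun h hl =>
    hx.monotoneOn (mem_Iic.2 (h.trans hl)) (mem_Iic.2 hl) h
  have at_left : w j * hat x j y = w j * ((x (j + 1) - y) / (x (j + 1) - x j)) := by
    rcases j.eq_zero_or_pos with rfl | hj₀
    · simp only [hw₀, zero_mul]
    · rw [hat_of_mem_Icc (lt (by omega) hj.le) (lt (by omega) hj) hy]
  rw [interp_eq_sum_range (by omega) hw₀ hwn,
    Finset.sum_eq_add j (j + 1) (by omega) ?_ (by simp; omega) (by simp; omega), at_left,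
    hat_succ_of_mem_Icc hy, linInterp]
  rintro k hk ⟨hkj, hkj'⟩
  have hkn : k ≤ n := Nat.lt_succ_iff.1 (Finset.mem_range.1 hk)
  rcases lt_or_gt_of_ne hkj with h | h
  · rw [hat_eq_zero_of_ge (lt (by omega) (by omega)) ((le (by omega) hj.le).trans hy.1), mul_zero]
  · rw [hat_eq_zero_of_le (lt (by omega) hkn) (hy.2.trans (le (by omega) (by omega))), mul_zero]

theorem hat_node (hx : StrictMonoOn x (Iic n)) {k i : ℕ} (hk : 0 < k) (hkn : k < n) (hi : i ≤ n) :
    hat x k (x i) = if k = i then 1 else 0 := by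
  have hlt : x (k - 1) < x k := hx (mem_Iic.2 (by omega)) (mem_Iic.2 hkn.le) (by omega)
  have hlt' : x k < x (k + 1) := hx (mem_Iic.2 hkn.le) (mem_Iic.2 hkn) (Nat.lt_succ_self k)
  rcases lt_trichotomy k i with h | rfl | h
  · rw [if_neg h.ne, hat_eq_zero_of_ge hlt' (hx.monotoneOn (mem_Iic.2 hkn) (mem_Iic.2 hi) h)]
  · rw [if_pos rfl, hat_of_mem_Icc hlt hlt' ⟨le_rfl, hlt'.le⟩, div_self (sub_pos.2 hlt').ne']
  · rw [if_neg h.ne', hat_eq_zero_of_le hlt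
      (hx.monotoneOn (mem_Iic.2 hi) (mem_Iic.2 (by omega)) (by omega))]

theorem interp_node (hx : StrictMonoOn x (Iic n)) {i : ℕ} (hi : 0 < i) (hin : i < n) :
    interp x n w (x i) = w i := by
  obtain ⟨m, rfl⟩ := Nat.exists_eq_add_of_le' hi
  rw [interp, Finset.sum_eq_single (⟨m, by omega⟩ : Fin (n - 1))]
  · rw [hat_node hx hi hin hin.le, if_pos rfl, mul_one]
  · intro k _ hk
    rw [hat_node hx (by omega) (by omega) hin.le,
      if_neg fun h => hk (Fin.ext (Nat.succ_injective h)), mul_zero]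
  · exact fun h => absurd (Finset.mem_univ _) h

theorem abs_interp_le (hx : StrictMonoOn x (Iic n)) (hn : 1 ≤ n) (hw₀ : w 0 = 0) (hwn : w n = 0)
    {B y : ℝ} (hw : ∀ k, |w k| ≤ B) (hy : y ∈ Icc (x 0) (x n)) : |interp x n w y| ≤ B := by
  obtain ⟨j, ⟨_, hj⟩, hyj⟩ := exists_mem_Icc_succ hn hy
  rw [interp_eq_linInterp hx hw₀ hwn hj hyj]
  exact abs_linInterp_le (hx (mem_Iic.2 hj.le) (mem_Iic.2 hj) (Nat.lt_succ_self j)) hyj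
    (hw j) (hw (j + 1))

theorem interpError_reflect (hx : StrictMonoOn x (Iic n)) (hn : 1 ≤ n) {s y : ℝ} {v : ℝ → ℝ}
    (hxs : ∀ j ≤ n, x (n - j) = s - x j) (hv₀ : v (x 0) = 0) (hvn : v (x n) = 0)
    (hy : y ∈ Icc (x 0) (x n)) :
    interpError x n (fun t => v (s - t)) y = interpError x n v (s - y) := by
  obtain ⟨j, ⟨_, hj⟩, hyj⟩ := exists_mem_Icc_succ hn hy
  obtain ⟨m, rfl⟩ := Nat.exists_eq_add_of_lt hj
  have hm : x m = s - x (j + 1) := by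
    rw [← hxs (j + 1) (by omega)]; congr 1; omega
  have hm' : x (m + 1) = s - x j := by
    rw [← hxs j (by omega)]; congr 1; omega
  have hends : s - x 0 = x (j + m + 1) ∧ s - x (j + m + 1) = x 0 := by
    rw [← hxs 0 (by omega), ← hxs (j + m + 1) le_rfl, Nat.sub_zero, Nat.sub_self]
    exact ⟨rfl, rfl⟩
  have hsy : s - y ∈ Icc (x m) (x (m + 1)) := by
    rw [hm, hm']; exact ⟨by linarith [hyj.2], by linarith [hyj.1]⟩
  have hcell : interp x (j + m + 1) (fun i => v (s - x i)) y =
      linInterp (x j) (x (j + 1)) (v (s - x j)) (v (s - x (j + 1))) y :=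
    interp_eq_linInterp hx (by rw [hends.1, hvn]) (by rw [hends.2, hv₀]) hj hyj
  have hcell' : interp x (j + m + 1) (v ∘ x) (s - y) =
      linInterp (x m) (x (m + 1)) (v (x m)) (v (x (m + 1))) (s - y) :=
    interp_eq_linInterp hx hv₀ hvn (by omega) hsy
  rw [interpError, interpError, hcell', hm, hm', linInterp_reflect, ← hcell]
  rfl

end Interp

/-! ### The interpolation error against the kernel -/

theorem weight_rpow_le {a b z : ℝ} (hz : z ∈ Ioc 0 ((b - a) / 2)) (p : ℝ) :
    ((a + z - a) * (b - (a + z))) ^ p ≤ (((b - a) / 2) ^ p + (b - a) ^ p) * z ^ p := by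
  have hL : 0 < (b - a) / 2 := hz.1.trans_le hz.2
  have hmem : b - (a + z) ∈ Icc ((b - a) / 2) (b - a) := ⟨by linarith [hz.2], by linarith [hz.1]⟩
  rw [add_sub_cancel_left, Real.mul_rpow hz.1.le (hL.le.trans hmem.1), mul_comm]
  exact mul_le_mul_of_nonneg_right (rpow_le_add_rpow hL hmem p) (Real.rpow_nonneg hz.1.le p)

theorem rpow_sub_two_mul_sq {z : ℝ} (hz : 0 < z) (σ r : ℝ) (N : ℕ) :
    z ^ (σ - 2) * ((N : ℝ)⁻¹ * z ^ (1 - 1 / r)) ^ 2 = (N : ℝ) ^ (-2 : ℝ) * z ^ (σ - 2 / r) := by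
  rw [mul_pow, mul_left_comm, ← Real.rpow_mul_natCast hz.le, ← Real.rpow_add hz,
    Real.rpow_neg (Nat.cast_nonneg N), Real.rpow_two, inv_pow]
  congr 2
  push_cast
  ring

/-- The spatial regularity class of the solution at a fixed time: `v` vanishes off `(a, b)`, is `C²`
inside, and `v` and `v''` are bounded by `K` times the powers `σ` and `σ - 2` of the weight
`(x - a)(b - x)`. -/
structure WeightedC2 (a b σ K : ℝ) (v : ℝ → ℝ) : Prop where
  contDiffOn : ContDiffOn ℝ 2 v (Ioo a b)
  eq_zero : ∀ x ∉ Ioo a b, v x = 0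
  abs_le : ∀ x ∈ Ioo a b, |v x| ≤ K * ((x - a) * (b - x)) ^ σ
  abs_iteratedDeriv_le : ∀ x ∈ Ioo a b,
    |iteratedDeriv 2 v x| ≤ K * ((x - a) * (b - x)) ^ (σ - 2)

namespace WeightedC2

variable {a b σ K r : ℝ} {v : ℝ → ℝ} {N : ℕ}

theorem nonneg (h : WeightedC2 a b σ K v) (hab : a < b) : 0 ≤ K := by
  obtain ⟨x, hx⟩ := nonempty_Ioo.2 hab
  exact nonneg_of_mul_nonneg_left ((abs_nonneg _).trans (h.abs_le x hx))
    (Real.rpow_pos_of_pos (mul_pos (sub_pos.2 hx.1) (sub_pos.2 hx.2)) _)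

theorem apply_left (h : WeightedC2 a b σ K v) : v a = 0 := h.eq_zero a fun ha => ha.1.false

theorem apply_right (h : WeightedC2 a b σ K v) : v b = 0 := h.eq_zero b fun hb => hb.2.false

theorem abs_le_const (h : WeightedC2 a b σ K v) (hab : a < b) (hσ : 0 ≤ σ) (y : ℝ) :
    |v y| ≤ K * ((b - a) * (b - a)) ^ σ := by
  have hK := h.nonneg hab
  have : 0 < b - a := sub_pos.2 hab
  by_cases hy : y ∈ Ioo a b
  · have hya : 0 < y - a := sub_pos.2 hy.1
    have hby : 0 < b - y := sub_pos.2 hy.2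
    refine (h.abs_le y hy).trans ?_
    gcongr
    exacts [hy.2.le, hy.1.le]
  · rw [h.eq_zero y hy, abs_zero]
    positivity

theorem aestronglyMeasurable (h : WeightedC2 a b σ K v) :
    AEStronglyMeasurable v (volume.restrict (Ioc a b)) := by
  rw [← Measure.restrict_congr_set Ioo_ae_eq_Ioc]
  exact h.contDiffOn.continuousOn.aestronglyMeasurable measurableSet_Ioo

theorem hasDerivAt (h : WeightedC2 a b σ K v) {x : ℝ} (hx : x ∈ Ioo a b) :
    HasDerivAt v (deriv v x) x :=
  ((h.contDiffOn.differentiableOn two_ne_zero).differentiableAt (isOpen_Ioo.mem_nhds hx)).hasDerivAt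

theorem hasDerivAt_deriv (h : WeightedC2 a b σ K v) {x : ℝ} (hx : x ∈ Ioo a b) :
    HasDerivAt (deriv v) (iteratedDeriv 2 v x) x := by
  have hderiv : ContDiffOn ℝ 1 (deriv v) (Ioo a b) :=
    h.contDiffOn.deriv_of_isOpen isOpen_Ioo (by norm_num)
  rw [iteratedDeriv_succ, iteratedDeriv_one]
  exact ((hderiv.differentiableOn one_ne_zero).differentiableAt
    (isOpen_Ioo.mem_nhds hx)).hasDerivAt

theorem reflect (h : WeightedC2 a b σ K v) : WeightedC2 a b σ K fun x => v (a + b - x) := by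
  have mem_iff : ∀ x, a + b - x ∈ Ioo a b ↔ x ∈ Ioo a b := fun x => by
    constructor <;> rintro ⟨h₁, h₂⟩ <;> constructor <;> linarith
  have weight_eq : ∀ x, (a + b - x - a) * (b - (a + b - x)) = (x - a) * (b - x) := fun x => by ring
  refine ⟨?_, fun x hx => h.eq_zero _ ((mem_iff x).not.2 hx), fun x hx => ?_, fun x hx => ?_⟩
  · exact h.contDiffOn.comp (contDiff_const.sub contDiff_id).contDiffOn fun x hx => (mem_iff x).2 hx
  · simpa only [weight_eq] using h.abs_le _ ((mem_iff x).2 hx)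
  · simpa only [iteratedDeriv_comp_const_sub, even_two.neg_one_pow, one_smul, weight_eq] using
      h.abs_iteratedDeriv_le _ ((mem_iff x).2 hx)

theorem interpError_eq_sub_linInterp (h : WeightedC2 a b σ K v) (hab : a < b) (hr : 0 < r) {j : ℕ}
    (hj : j < N) {z : ℝ}
    (hz : z ∈ Icc (gradedNode ((b - a) / 2) r N j) (gradedNode ((b - a) / 2) r N (j + 1))) :
    interpError (node a b r N) (2 * N) v (a + z) =
      v (a + z) - linInterp (a + gradedNode ((b - a) / 2) r N j)
        (a + gradedNode ((b - a) / 2) r N (j + 1)) (v (a + gradedNode ((b - a) / 2) r N j))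
        (v (a + gradedNode ((b - a) / 2) r N (j + 1))) (a + z) := by
  have hN : 1 ≤ N := by omega
  have left : node a b r N j = a + gradedNode ((b - a) / 2) r N j := node_of_le hj.le
  have right : node a b r N (j + 1) = a + gradedNode ((b - a) / 2) r N (j + 1) := node_of_le hj
  rw [interpError, interp_eq_linInterp (node_strictMonoOn hab hr hN) _ _ (show j < 2 * N by omega)]
  · simp only [Function.comp_apply, left, right]
  · rw [left, right]
    exact ⟨by linarith [hz.1], by linarith [hz.2]⟩
  · rw [Function.comp_apply, node_zero hr, h.apply_left]
  · rw [Function.comp_apply, node_last hr hN, h.apply_right]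

theorem abs_interpError_le_first_cell (h : WeightedC2 a b σ K v) (hab : a < b) (hσ : 0 ≤ σ)
    (hr : 0 < r) (hN : 1 ≤ N) {z : ℝ} (hz : z ∈ Ioc 0 (gradedNode ((b - a) / 2) r N 1)) :
    |interpError (node a b r N) (2 * N) v (a + z)| ≤
      K * (2 * (((b - a) / 2) ^ σ + (b - a) ^ σ)) * gradedNode ((b - a) / 2) r N 1 ^ σ := by
  have hba : 0 < b - a := sub_pos.2 hab
  have hK := h.nonneg hab
  have hcell := h.interpError_eq_sub_linInterp hab hr (j := 0) (z := z) hN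
    (by rw [gradedNode_zero hr]; exact Ioc_subset_Icc_self hz)
  rw [gradedNode_zero hr, zero_add, add_zero] at hcell
  set g := gradedNode ((b - a) / 2) r N 1
  have hg : 0 < g := hz.1.trans_le hz.2
  have hgL : g ≤ (b - a) / 2 := gradedNode_one_le (half_pos hba) hr hN
  set B := K * ((((b - a) / 2) ^ σ + (b - a) ^ σ) * g ^ σ) with hB
  have abs_le : ∀ ζ ∈ Ioc 0 g, |v (a + ζ)| ≤ B := fun ζ ⟨hζ, hζg⟩ => by
    refine (h.abs_le _ ⟨by linarith, by linarith⟩).trans (mul_le_mul_of_nonneg_left ?_ hK)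
    refine (weight_rpow_le ⟨hζ, hζg.trans hgL⟩ σ).trans ?_
    gcongr
  calc |interpError (node a b r N) (2 * N) v (a + z)|
      ≤ |v (a + z)| + |linInterp a (a + g) (v a) (v (a + g)) (a + z)| := hcell ▸ abs_sub _ _
    _ ≤ B + B := by
        refine add_le_add (abs_le z hz) (abs_linInterp_le (by linarith)
          ⟨by linarith [hz.1], by linarith [hz.2]⟩ ?_ (abs_le g ⟨hg, le_rfl⟩))
        rw [h.apply_left, abs_zero]
        positivity
    _ = K * (2 * (((b - a) / 2) ^ σ + (b - a) ^ σ)) * g ^ σ := by rw [hB]; ring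

theorem abs_iteratedDeriv_le_of_le_mul (h : WeightedC2 a b σ K v) (hab : a < b) {κ z ξ : ℝ}
    (hz : 0 < z) (hξ : ξ ∈ Ioc 0 ((b - a) / 2)) (hξz : ξ ≤ κ * z) (hzξ : z ≤ κ * ξ) :
    |iteratedDeriv 2 v (a + ξ)| ≤
      K * (((b - a) / 2) ^ (σ - 2) + (b - a) ^ (σ - 2)) * κ ^ |σ - 2| * z ^ (σ - 2) := by
  have : 0 < b - a := sub_pos.2 hab
  have hK := h.nonneg hab
  refine (h.abs_iteratedDeriv_le _ ⟨by linarith [hξ.1], by linarith [hξ.2]⟩).trans ?_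
  rw [mul_assoc, mul_assoc]
  refine mul_le_mul_of_nonneg_left ((weight_rpow_le hξ _).trans ?_) hK
  exact mul_le_mul_of_nonneg_left (rpow_le_rpow_abs_mul_rpow _ hξ.1 hz hξz hzξ) (by positivity)

theorem abs_iteratedDeriv_le_inner_cell (h : WeightedC2 a b σ K v) (hab : a < b) (hr : 0 < r)
    {j : ℕ} (hj : 1 ≤ j) (hjN : j < N) {z ξ : ℝ}
    (hz : z ∈ Icc (gradedNode ((b - a) / 2) r N j) (gradedNode ((b - a) / 2) r N (j + 1)))
    (hξ : ξ ∈ Icc (gradedNode ((b - a) / 2) r N j) (gradedNode ((b - a) / 2) r N (j + 1))) :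
    |iteratedDeriv 2 v (a + ξ)| ≤
      K * (((b - a) / 2) ^ (σ - 2) + (b - a) ^ (σ - 2)) * (2 ^ r) ^ |σ - 2| * z ^ (σ - 2) := by
  have hL : 0 < (b - a) / 2 := half_pos (sub_pos.2 hab)
  have hN : 1 ≤ N := by omega
  have hpos : 0 < gradedNode ((b - a) / 2) r N j := gradedNode_pos hL hN hj
  have hratio := gradedNode_succ_le (N := N) hL hr hj
  have hend : gradedNode ((b - a) / 2) r N (j + 1) ≤ (b - a) / 2 :=
    ((gradedNode_strictMono hL hr hN).monotone hjN).trans_eq (gradedNode_self hN)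
  exact h.abs_iteratedDeriv_le_of_le_mul hab (hpos.trans_le hz.1)
    ⟨hpos.trans_le hξ.1, hξ.2.trans hend⟩
    (hξ.2.trans (hratio.trans (by gcongr; exact hz.1)))
    (hz.2.trans (hratio.trans (by gcongr; exact hξ.1)))

theorem exists_abs_interpError_le_inner_cell (hab : a < b) (σ : ℝ) (hr : 0 < r) :
    ∃ C, 0 ≤ C ∧ ∀ (K : ℝ) (v : ℝ → ℝ) (N j : ℕ), WeightedC2 a b σ K v → 1 ≤ j → j < N →
      ∀ z ∈ Icc (gradedNode ((b - a) / 2) r N j) (gradedNode ((b - a) / 2) r N (j + 1)),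
        |interpError (node a b r N) (2 * N) v (a + z)| ≤
          K * C * (N : ℝ) ^ (-2 : ℝ) * z ^ (σ - 2 / r) := by
  have hba : 0 < b - a := sub_pos.2 hab
  have hL : 0 < (b - a) / 2 := half_pos hba
  set Q := (((b - a) / 2) ^ (σ - 2) + (b - a) ^ (σ - 2)) * ((2 : ℝ) ^ r) ^ |σ - 2|
  set H := r * 2 ^ |r - 1| * ((b - a) / 2) ^ (1 / r)
  refine ⟨Q * H ^ 2, by positivity, fun K v N j h hj hjN z hz => ?_⟩
  have hK := h.nonneg hab
  have hN : 1 ≤ N := by omega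
  have hg_mono := gradedNode_strictMono hL hr hN
  rw [h.interpError_eq_sub_linInterp hab hr hjN hz]
  set c := gradedNode ((b - a) / 2) r N j
  set d := gradedNode ((b - a) / 2) r N (j + 1)
  have hc : 0 < c := gradedNode_pos hL hN hj
  have hcd : c < d := hg_mono (Nat.lt_succ_self j)
  have hdL : d ≤ (b - a) / 2 := (hg_mono.monotone hjN).trans_eq (gradedNode_self hN)
  have hz₀ : 0 < z := hc.trans_le hz.1
  have mem_Ioo : ∀ x ∈ Icc (a + c) (a + d), x ∈ Ioo a b := fun x hx =>
    ⟨by linarith [hx.1], by linarith [hx.2]⟩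
  have second_deriv : ∀ x ∈ Icc (a + c) (a + d),
      |iteratedDeriv 2 v x| ≤ K * Q * z ^ (σ - 2) := fun x hx => by
    rw [← add_sub_cancel a x, ← mul_assoc K]
    exact h.abs_iteratedDeriv_le_inner_cell hab hr hj hjN hz
      ⟨by linarith [hx.1], by linarith [hx.2]⟩
  calc _ ≤ K * Q * z ^ (σ - 2) * (a + d - (a + c)) ^ 2 :=
        abs_sub_linInterp_le (by linarith) (fun x hx => h.hasDerivAt (mem_Ioo x hx))
          (fun x hx => h.hasDerivAt_deriv (mem_Ioo x hx)) second_deriv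
          ⟨by linarith [hz.1], by linarith [hz.2]⟩
    _ ≤ K * Q * z ^ (σ - 2) * (H * ((N : ℝ)⁻¹ * z ^ (1 - 1 / r))) ^ 2 := by
        rw [add_sub_add_left_eq_sub]
        have := sub_nonneg.2 hcd.le
        gcongr
        exact gradedNode_succ_sub_le hL hr hN hj hz
    _ = K * (Q * H ^ 2) * (z ^ (σ - 2) * ((N : ℝ)⁻¹ * z ^ (1 - 1 / r)) ^ 2) := by ring
    _ = K * (Q * H ^ 2) * (N : ℝ) ^ (-2 : ℝ) * z ^ (σ - 2 / r) := by
        rw [rpow_sub_two_mul_sq hz₀, mul_assoc _ ((N : ℝ) ^ (-2 : ℝ))]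

theorem exists_abs_interpError_le (hab : a < b) (hσ : 0 ≤ σ) (hr : 0 < r) :
    ∃ C, 0 ≤ C ∧ ∀ (K : ℝ) (v : ℝ → ℝ) (N : ℕ), WeightedC2 a b σ K v → 1 ≤ N →
      (∀ z ∈ Ioc 0 (gradedNode ((b - a) / 2) r N 1),
        |interpError (node a b r N) (2 * N) v (a + z)| ≤
          K * C * gradedNode ((b - a) / 2) r N 1 ^ σ) ∧
      ∀ z ∈ Ioc (gradedNode ((b - a) / 2) r N 1) ((b - a) / 2),
        |interpError (node a b r N) (2 * N) v (a + z)| ≤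
          K * C * (N : ℝ) ^ (-2 : ℝ) * z ^ (σ - 2 / r) := by
  have hba : 0 < b - a := sub_pos.2 hab
  have hL : 0 < (b - a) / 2 := half_pos hba
  obtain ⟨C, hC, inner⟩ := exists_abs_interpError_le_inner_cell hab σ hr
  set C₁ := 2 * (((b - a) / 2) ^ σ + (b - a) ^ σ)
  have hC₁ : 0 ≤ C₁ := by positivity
  refine ⟨C₁ + C, by positivity, fun K v N h hN => ?_⟩
  have hK := h.nonneg hab
  have hg_mono := gradedNode_strictMono hL hr hN
  have hg₁ := gradedNode_pos (r := r) hL hN le_rfl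
  refine ⟨fun z hz => (h.abs_interpError_le_first_cell hab hσ hr hN hz).trans ?_, fun z hz => ?_⟩
  · gcongr
    exact le_add_of_nonneg_right hC
  · obtain ⟨j, ⟨hj, hjN⟩, hzj⟩ := exists_mem_Icc_succ (x := gradedNode ((b - a) / 2) r N)
      (hg_mono.lt_iff_lt.1 ((hz.1.trans_le hz.2).trans_eq (gradedNode_self hN).symm))
      ⟨hz.1.le, hz.2.trans_eq (gradedNode_self hN).symm⟩
    have := hg₁.trans hz.1
    refine (inner K v N j h hj hjN z hzj).trans ?_
    gcongr
    exact le_add_of_nonneg_left hC₁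

theorem intervalIntegrable_interpError_mul_kernel {α : ℝ} (h : WeightedC2 a b σ K v) (hab : a < b)
    (hσ : 0 ≤ σ) (hr : 0 < r) (hN : 1 ≤ N) (hα : α < 1) (x : ℝ) :
    IntervalIntegrable (fun y => interpError (node a b r N) (2 * N) v y * |x - y| ^ (-α))
      volume a b := by
  set B := K * ((b - a) * (b - a)) ^ σ
  refine intervalIntegrable_mul_kernel (B := B + B) hα x hab.le (h.aestronglyMeasurable.sub
    (measurable_interp _ _ _).aestronglyMeasurable) fun y hy => (abs_sub _ _).trans
      (add_le_add (h.abs_le_const hab hσ y) ?_)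
  refine abs_interp_le (node_strictMonoOn hab hr hN) (by omega) ?_ ?_
    (fun k => h.abs_le_const hab hσ _) ?_
  · rw [Function.comp_apply, node_zero hr, h.apply_left]
  · rw [Function.comp_apply, node_last hr hN, h.apply_right]
  · rw [node_zero hr, node_last hr hN]
    exact Ioc_subset_Icc_self hy

theorem exists_bound_integral_left_half {α : ℝ} (hab : a < b) (hσ : 0 ≤ σ) (hr : 0 < r)
    (hα₀ : 0 ≤ α) (hα₁ : α < 1) :
    ∃ C, 0 ≤ C ∧ ∀ (K : ℝ) (v : ℝ → ℝ) (N i : ℕ), WeightedC2 a b σ K v → 1 ≤ N →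
      (r * (1 + σ - α) = 2 → 2 ≤ N) → 0 < i → i < 2 * N →
      |∫ y in a..(a + (b - a) / 2),
          interpError (node a b r N) (2 * N) v y * |node a b r N i - y| ^ (-α)| ≤
        K * C * gradedRate (r * (1 + σ - α)) N := by
  have hL : 0 < (b - a) / 2 := half_pos (sub_pos.2 hab)
  obtain ⟨C₁, hC₁, pointwise⟩ := exists_abs_interpError_le hab hσ hr
  obtain ⟨C₂, hC₂, integral_le⟩ := exists_bound_integral_mul_kernel_graded (σ := σ) hL hr hα₀ hα₁
  refine ⟨C₁ * C₂, by positivity, fun K v N i h hN hN₂ hi hiN => ?_⟩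
  obtain ⟨first, inner⟩ := pointwise K v N h hN
  set x := node a b r N
  have hxi : x i - a ∈ Icc (gradedNode ((b - a) / 2) r N 1) (2 * ((b - a) / 2)) := by
    have hmono : x 1 ≤ x i := (node_strictMonoOn hab hr hN).monotoneOn
      (mem_Iic.2 (by omega)) (mem_Iic.2 hiN.le) hi
    have hx₁ : x 1 = a + gradedNode ((b - a) / 2) r N 1 := node_of_le hN
    exact ⟨by linarith, by linarith [(node_mem_Ioo hab hr hi hiN : x i ∈ Ioo a b).2]⟩
  have hint : IntervalIntegrable (fun z => interpError x (2 * N) v (a + z) * |x i - a - z| ^ (-α))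
      volume 0 ((b - a) / 2) := by
    have := ((h.intervalIntegrable_interpError_mul_kernel hab hσ hr hN hα₁ (x i)).comp_add_left
      a).mono_set (c := 0) (d := (b - a) / 2) ?_
    · simpa only [sub_add_eq_sub_sub] using this
    · rw [sub_self, uIcc_of_le hL.le, uIcc_of_le (sub_pos.2 hab).le]
      exact Icc_subset_Icc_right (half_le_self (sub_pos.2 hab).le)
  have shift : ∫ z in (0 : ℝ)..(b - a) / 2,
      interpError x (2 * N) v (a + z) * |x i - a - z| ^ (-α) =
        ∫ y in a..(a + (b - a) / 2), interpError x (2 * N) v y * |x i - y| ^ (-α) := by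
    simpa only [sub_add_eq_sub_sub, add_zero] using intervalIntegral.integral_comp_add_left
      (a := 0) (b := (b - a) / 2) (fun y => interpError x (2 * N) v y * |x i - y| ^ (-α)) a
  rw [← shift, ← mul_assoc]
  exact integral_le N (K * C₁) (x i - a) _ hN hN₂ (mul_nonneg (h.nonneg hab) hC₁) hxi hint
    first inner

theorem integral_right_half_eq (h : WeightedC2 a b σ K v) (hab : a < b) (hr : 0 < r) (hN : 1 ≤ N)
    {i : ℕ} (hi : i ≤ 2 * N) (α : ℝ) :
    ∫ y in (a + (b - a) / 2)..b,
        interpError (node a b r N) (2 * N) v y * |node a b r N i - y| ^ (-α) =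
      ∫ y in a..(a + (b - a) / 2),
        interpError (node a b r N) (2 * N) (fun t => v (a + b - t)) y *
          |node a b r N (2 * N - i) - y| ^ (-α) := by
  have hmid : a + b - (a + (b - a) / 2) = a + (b - a) / 2 := by ring
  have reflected := intervalIntegral.integral_comp_sub_left (a := a) (b := a + (b - a) / 2)
    (fun y => interpError (node a b r N) (2 * N) v y * |node a b r N i - y| ^ (-α)) (a + b)
  rw [hmid, add_sub_cancel_left] at reflected
  rw [← reflected]
  refine intervalIntegral.integral_congr fun y hy => ?_
  rw [uIcc_of_le (by linarith)] at hy
  have hends : node a b r N 0 = a ∧ node a b r N (2 * N) = b := ⟨node_zero hr, node_last hr hN⟩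
  rw [interpError_reflect (node_strictMonoOn hab hr hN) (by omega)
      (fun j hj => node_two_mul_sub hN hj) (by rw [hends.1, h.apply_left])
      (by rw [hends.2, h.apply_right])
      (by rw [hends.1, hends.2]; exact ⟨hy.1, by linarith [hy.2]⟩),
    node_two_mul_sub hN hi, ← abs_neg (a + b - _ - y)]
  ring_nf

theorem exists_bound_integral_interpError {α : ℝ} (hab : a < b) (hσ : 0 ≤ σ) (hr : 0 < r)
    (hα₀ : 0 ≤ α) (hα₁ : α < 1) :
    ∃ C, 0 ≤ C ∧ ∀ (K : ℝ) (v : ℝ → ℝ) (N i : ℕ), WeightedC2 a b σ K v → 1 ≤ N →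
      (r * (1 + σ - α) = 2 → 2 ≤ N) → 0 < i → i < 2 * N →
      |∫ y in a..b, interpError (node a b r N) (2 * N) v y * |node a b r N i - y| ^ (-α)| ≤
        K * C * gradedRate (r * (1 + σ - α)) N := by
  obtain ⟨C, hC, half⟩ := exists_bound_integral_left_half hab hσ hr hα₀ hα₁
  refine ⟨C + C, by positivity, fun K v N i h hN hN₂ hi hiN => ?_⟩
  have hint := h.intervalIntegrable_interpError_mul_kernel hab hσ hr hN hα₁ (node a b r N i)
  have hmid : a + (b - a) / 2 ∈ Icc a b := ⟨by linarith, by linarith⟩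
  have left := half K v N i h hN hN₂ hi hiN
  have right := half K _ N (2 * N - i) h.reflect hN hN₂ (by omega) (by omega)
  rw [← h.integral_right_half_eq hab hr hN hiN.le] at right
  rw [← intervalIntegral.integral_add_adjacent_intervals (b := a + (b - a) / 2)
    (hint.mono_set (by
      rw [uIcc_of_le hmid.1, uIcc_of_le hab.le]; exact Icc_subset_Icc_right hmid.2))
    (hint.mono_set (by
      rw [uIcc_of_le hmid.2, uIcc_of_le hab.le]; exact Icc_subset_Icc_left hmid.1))]
  exact (abs_add_le _ _).trans ((add_le_add left right).trans_eq (by ring))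

end WeightedC2

theorem exists_weightedC2 {a b α σ : ℝ} {u₀ : ℝ → ℝ} {f u : ℝ → ℝ → ℝ}
    (hsol : IsSolution a b α u₀ f u) (hspace : SpaceRegular a b σ u) :
    ∃ K, ∀ t ∈ Icc (0 : ℝ) 1, WeightedC2 a b σ K fun x => u x t := by
  obtain ⟨contDiffOn, K, bound⟩ := hspace
  refine ⟨K, fun t ht => ⟨contDiffOn t ht, fun x hx => hsol.exterior x hx t ht, fun x hx => ?_,
    fun x hx => bound 2 le_rfl t ht x hx⟩⟩
  simpa only [iteratedDeriv_zero, Nat.cast_zero, sub_zero] using bound 0 two_pos.le t ht x hx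

/-! ### Matrix and stability -/

section Stiffness

variable {a b α r : ℝ} {N : ℕ}

theorem div_abs_rpow_eq (v z α : ℝ) : v / |z| ^ α = v * |z| ^ (-α) := by
  rw [Real.rpow_neg (abs_nonneg z), div_eq_mul_inv]

theorem coeff_eq (a b α r : ℝ) (N i k : ℕ) :
    coeff a b α r N i k = ∫ y in a..b,
      (hat (node a b r N) k (node a b r N i) - hat (node a b r N) k y) *
        |node a b r N i - y| ^ (-α) := by
  simp only [coeff, div_abs_rpow_eq]

theorem intervalIntegrable_sub_hat_mul_kernel (hab : a < b) (hα : α < 1) (x : ℕ → ℝ) (k : ℕ)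
    (v z : ℝ) : IntervalIntegrable (fun y => (v - hat x k y) * |z - y| ^ (-α)) volume a b := by
  refine intervalIntegrable_mul_kernel (B := |v| + 1) hα z hab.le
    (measurable_const.sub (measurable_hat x k)).aestronglyMeasurable fun y _ =>
      (abs_sub _ _).trans (add_le_add le_rfl ?_)
  rw [abs_of_nonneg (hat_nonneg x k y)]
  exact hat_le_one x k y

theorem stiffness_mulVec (hab : a < b) (hα : α < 1) (w : ℕ → ℝ) (i : Fin (2 * N - 1)) :
    (stiffness a b α r N).mulVec (fun k => w (k + 1)) i =
      ∫ y in a..b, (interp (node a b r N) (2 * N) w (node a b r N (i + 1)) -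
        interp (node a b r N) (2 * N) w y) * |node a b r N (i + 1) - y| ^ (-α) := by
  simp only [Matrix.mulVec, dotProduct, stiffness, Matrix.of_apply, coeff_eq,
    ← intervalIntegral.integral_mul_const]
  rw [← intervalIntegral.integral_finsetSum fun k _ =>
    (intervalIntegrable_sub_hat_mul_kernel hab hα _ _ _ _).mul_const _]
  congr 1
  ext y
  rw [interp, interp, ← Finset.sum_sub_distrib, Finset.sum_mul]
  exact Finset.sum_congr rfl fun k _ => by ring

theorem coeff_nonpos (hab : a < b) (hr : 0 < r) {i k : ℕ} (hi : i < 2 * N) (hk : 0 < k)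
    (hkN : k < 2 * N) (hki : k ≠ i) : coeff a b α r N i k ≤ 0 := by
  rw [coeff_eq, hat_node (node_strictMonoOn hab hr (by omega)) hk hkN hi.le, if_neg hki,
    ← neg_nonneg, ← intervalIntegral.integral_neg]
  refine intervalIntegral.integral_nonneg hab.le fun y _ => ?_
  rw [zero_sub, neg_mul, neg_neg]
  exact mul_nonneg (hat_nonneg _ _ _) (Real.rpow_nonneg (abs_nonneg _) _)

theorem coeff_self_le (hab : a < b) (hα₀ : 0 ≤ α) (hα : α < 1) (hr : 0 < r) {i : ℕ} (hi : 0 < i)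
    (hiN : i < 2 * N) : coeff a b α r N i i ≤ 2 / (1 - α) * (b - a) ^ (1 - α) := by
  rw [coeff_eq, hat_node (node_strictMonoOn hab hr (by omega)) hi hiN hiN.le, if_pos rfl,
    ← one_mul (2 / (1 - α) * (b - a) ^ (1 - α))]
  refine (le_abs_self _).trans
    (abs_integral_mul_kernel_le hα₀ hα _ hab.le zero_le_one fun y _ => ?_)
  rw [abs_of_nonneg (sub_nonneg.2 (hat_le_one _ _ _))]
  exact sub_le_self _ (hat_nonneg _ _ _)

theorem sum_stiffness_nonneg (hab : a < b) (hα : α < 1) (hr : 0 < r) (i : Fin (2 * N - 1)) :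
    0 ≤ ∑ k, stiffness a b α r N i k := by
  have hN : 1 ≤ N := by have := i.isLt; omega
  have hmono : StrictMonoOn (node a b r N) (Iic (2 * N)) := node_strictMonoOn hab hr hN
  set w : ℕ → ℝ := (Ioo 0 (2 * N)).indicator 1 with hw
  have hw₁ : ∀ k : Fin (2 * N - 1), w (k + 1) = 1 := fun k =>
    indicator_of_mem (mem_Ioo.2 ⟨by omega, by omega⟩) _
  have row_sum : ∑ k, stiffness a b α r N i k =
      (stiffness a b α r N).mulVec (fun k => w (k + 1)) i := by
    simp only [Matrix.mulVec, dotProduct, hw₁, mul_one]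
  have interp_le : ∀ y ∈ Icc a b, interp (node a b r N) (2 * N) w y ≤ 1 := fun y hy => by
    refine (le_abs_self _).trans (abs_interp_le hmono (by omega) ?_ ?_ (fun k => ?_) ?_)
    · exact indicator_of_notMem (fun h => h.1.false) _
    · exact indicator_of_notMem (fun h => h.2.false) _
    · rw [hw, indicator_apply]
      split_ifs <;> simp
    · rwa [node_zero hr, node_last hr hN]
  rw [row_sum, stiffness_mulVec hab hα]
  refine intervalIntegral.integral_nonneg hab.le fun y hy => ?_
  rw [interp_node hmono (by omega) (by omega), hw₁]
  exact mul_nonneg (sub_nonneg.2 (interp_le y hy)) (Real.rpow_nonneg (abs_nonneg _) _)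

end Stiffness

section Stability

variable {ι : Type*} [Fintype ι] [DecidableEq ι] {A : Matrix ι ι ℝ} {c D : ℝ}

/-- Weak diagonal dominance by rows, with a nonnegative diagonal. This is what makes `1 + c • A`,
`0 ≤ c`, expansive in the maximum norm. -/
def IsRowDominant (A : Matrix ι ι ℝ) : Prop :=
  ∀ i, ∑ k ∈ Finset.univ.erase i, |A i k| ≤ A i i

theorem isRowDominant_of_nonpos (hoff : ∀ i k, i ≠ k → A i k ≤ 0) (hrow : ∀ i, 0 ≤ ∑ k, A i k) :
    IsRowDominant A := fun i => by
  rw [Finset.sum_congr rfl fun k hk =>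
    abs_of_nonpos (hoff i k (Finset.ne_of_mem_erase hk).symm), Finset.sum_neg_distrib]
  linarith [hrow i, Finset.add_sum_erase Finset.univ (A i) (Finset.mem_univ i)]

theorem mulVec_apply_eq_add_erase (A : Matrix ι ι ℝ) (v : ι → ℝ) (i : ι) :
    A.mulVec v i = A i i * v i + ∑ k ∈ Finset.univ.erase i, A i k * v k :=
  (Finset.add_sum_erase Finset.univ (fun k => A i k * v k) (Finset.mem_univ i)).symm

theorem IsRowDominant.abs_sum_erase_le (hA : IsRowDominant A) (v : ι → ℝ) (i : ι) :
    |∑ k ∈ Finset.univ.erase i, A i k * v k| ≤ A i i * ‖v‖ :=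
  calc |∑ k ∈ Finset.univ.erase i, A i k * v k|
      ≤ ∑ k ∈ Finset.univ.erase i, |A i k| * ‖v‖ := by
        refine (Finset.abs_sum_le_sum_abs _ _).trans (Finset.sum_le_sum fun k _ => ?_)
        rw [abs_mul]
        exact mul_le_mul_of_nonneg_left (norm_le_pi_norm v k) (abs_nonneg _)
    _ ≤ A i i * ‖v‖ := by
        rw [← Finset.sum_mul]
        exact mul_le_mul_of_nonneg_right (hA i) (norm_nonneg v)

theorem IsRowDominant.diag_nonneg (hA : IsRowDominant A) (i : ι) : 0 ≤ A i i :=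
  (Finset.sum_nonneg fun _ _ => abs_nonneg _).trans (hA i)

theorem IsRowDominant.norm_le_norm_one_add (hA : IsRowDominant A) (hc : 0 ≤ c) (v : ι → ℝ) :
    ‖v‖ ≤ ‖(1 + c • A).mulVec v‖ := by
  refine (pi_norm_le_iff_of_nonneg (norm_nonneg _)).2 fun i => (norm_le_pi_norm v i).trans ?_
  obtain ⟨m, -, hmax⟩ := Finset.exists_max_image Finset.univ (fun i => |v i|) ⟨i, Finset.mem_univ i⟩
  have hm : ‖v‖ = |v m| := le_antisymm
    ((pi_norm_le_iff_of_nonneg (abs_nonneg _)).2 fun k => hmax k (Finset.mem_univ k))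
    (norm_le_pi_norm v m)
  set s := ∑ k ∈ Finset.univ.erase m, A m k * v k
  have hs : |s| ≤ A m m * ‖v‖ := hA.abs_sum_erase_le v m
  have hdiag := hA.diag_nonneg m
  have apply_eq : (1 + c • A).mulVec v m = (1 + c * A m m) * v m + c * s := by
    rw [Matrix.add_mulVec, Matrix.one_mulVec, Matrix.smul_mulVec, Pi.add_apply, Pi.smul_apply,
      mulVec_apply_eq_add_erase, smul_eq_mul]
    ring
  calc ‖v‖ ≤ (1 + c * A m m) * ‖v‖ - c * |s| := by
        linarith [mul_le_mul_of_nonneg_left hs hc]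
    _ = |(1 + c * A m m) * v m| - |c * s| := by
        rw [abs_mul, abs_mul, abs_of_nonneg hc,
          abs_of_nonneg (show 0 ≤ 1 + c * A m m by positivity), hm]
    _ ≤ |(1 + c • A).mulVec v m| := by
        rw [apply_eq]
        simpa only [abs_neg, sub_neg_eq_add] using abs_sub_abs_le_abs_sub _ (-(c * s))
    _ ≤ ‖(1 + c • A).mulVec v‖ := norm_le_pi_norm ((1 + c • A).mulVec v) m

theorem IsRowDominant.norm_one_sub_le (hA : IsRowDominant A) (hc : 0 ≤ c) (hD₀ : 0 ≤ D)
    (hD : ∀ i, A i i ≤ D) (v : ι → ℝ) : ‖(1 - c • A).mulVec v‖ ≤ (1 + 2 * c * D) * ‖v‖ := by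
  refine (pi_norm_le_iff_of_nonneg (by positivity)).2 fun i => ?_
  have hvi : |v i| ≤ ‖v‖ := norm_le_pi_norm v i
  have hAv : |A.mulVec v i| ≤ 2 * D * ‖v‖ :=
    calc |A.mulVec v i| ≤ A i i * |v i| + A i i * ‖v‖ := by
          rw [mulVec_apply_eq_add_erase]
          refine (abs_add_le _ _).trans (add_le_add ?_ (hA.abs_sum_erase_le v i))
          rw [abs_mul, abs_of_nonneg (hA.diag_nonneg i)]
      _ ≤ D * ‖v‖ + D * ‖v‖ := by gcongr <;> exact hD i
      _ = 2 * D * ‖v‖ := by ring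
  calc |(1 - c • A).mulVec v i| ≤ |v i| + c * |A.mulVec v i| := by
        rw [Matrix.sub_mulVec, Matrix.one_mulVec, Matrix.smul_mulVec, Pi.sub_apply, Pi.smul_apply,
          smul_eq_mul]
        simpa only [abs_mul, abs_of_nonneg hc] using abs_sub (v i) (c * A.mulVec v i)
    _ ≤ ‖v‖ + c * (2 * D * ‖v‖) := by gcongr
    _ = (1 + 2 * c * D) * ‖v‖ := by ring

theorem IsRowDominant.norm_crankNicolson_le (hA : IsRowDominant A) (hD₀ : 0 ≤ D)
    (hD : ∀ i, A i i ≤ D) {τ ρ : ℝ} (hτ : 0 ≤ τ) (hρ : 0 ≤ ρ) {M : ℕ} {e R : ℕ → ι → ℝ}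
    (he₀ : e 0 = 0)
    (hstep : ∀ j < M, (1 + (τ / 2) • A).mulVec (e (j + 1)) =
      (1 - (τ / 2) • A).mulVec (e j) + τ • R j)
    (hR : ∀ j < M, ‖R j‖ ≤ ρ) {k : ℕ} (hk : k ≤ M) :
    ‖e k‖ ≤ Real.exp (k * τ * D) * (k * τ * ρ) := by
  induction k with
  | zero => simp only [he₀, norm_zero, Nat.cast_zero, zero_mul, mul_zero, le_refl]
  | succ k ih =>
    have hpropagate := hA.norm_one_sub_le (div_nonneg hτ two_pos.le) hD₀ hD (e k)
    have hgrowth : (1 + τ * D) * Real.exp (k * τ * D) ≤ Real.exp ((k + 1) * τ * D) := by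
      rw [show (k + 1) * τ * D = τ * D + k * τ * D by ring, Real.exp_add, add_comm 1]
      exact mul_le_mul_of_nonneg_right (Real.add_one_le_exp _) (Real.exp_pos _).le
    calc ‖e (k + 1)‖ ≤ ‖(1 - (τ / 2) • A).mulVec (e k) + τ • R k‖ :=
          hstep k hk ▸ hA.norm_le_norm_one_add (div_nonneg hτ two_pos.le) (e (k + 1))
      _ ≤ (1 + 2 * (τ / 2) * D) * ‖e k‖ + τ * ‖R k‖ := by
          refine (norm_add_le _ _).trans (add_le_add hpropagate ?_)
          rw [norm_smul, Real.norm_of_nonneg hτ]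
      _ ≤ (1 + τ * D) * (Real.exp (k * τ * D) * (k * τ * ρ)) + 1 * (τ * ρ) := by
          rw [mul_div_cancel₀ τ two_ne_zero, one_mul]
          gcongr
          · exact ih (by omega)
          · exact hR k hk
      _ ≤ Real.exp ((k + 1) * τ * D) * (k * τ * ρ) + Real.exp ((k + 1) * τ * D) * (τ * ρ) := by
          rw [← mul_assoc]
          gcongr
          exact Real.one_le_exp (by positivity)
      _ = Real.exp ((k + 1 : ℕ) * τ * D) * ((k + 1 : ℕ) * τ * ρ) := by push_cast; ring

/-- What is left over when `V₀` and `V₁` are inserted for two successive iterates into the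
Crank–Nicolson scheme for `V' + A V = F` with step `τ`, normalized as a difference quotient. -/
noncomputable def crankNicolsonResidual (A : Matrix ι ι ℝ) (τ : ℝ) (V₀ V₁ F : ι → ℝ) : ι → ℝ :=
  τ⁻¹ • (V₁ - V₀) + (1 / 2 : ℝ) • A.mulVec (V₁ + V₀) - F

theorem crankNicolson_error_step {τ : ℝ} {V₀ V₁ U₀ U₁ F : ι → ℝ} (hτ : τ ≠ 0)
    (hU : (1 + (τ / 2) • A).mulVec U₁ = (1 - (τ / 2) • A).mulVec U₀ + τ • F) :
    (1 + (τ / 2) • A).mulVec (V₁ - U₁) =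
      (1 - (τ / 2) • A).mulVec (V₀ - U₀) + τ • crankNicolsonResidual A τ V₀ V₁ F := by
  rw [Matrix.mulVec_sub, hU, Matrix.mulVec_sub]
  ext i
  simp only [crankNicolsonResidual, Matrix.add_mulVec, Matrix.sub_mulVec, Matrix.one_mulVec,
    Matrix.smul_mulVec, Matrix.mulVec_add, Pi.sub_apply, Pi.add_apply, Pi.smul_apply, smul_eq_mul]
  field_simp
  ring

end Stability

/-! ### Differences in time -/

section TimeDifferences

variable {S : Set ℝ} {g g₁ g₂ g₃ : ℝ → ℝ} {s t h C : ℝ}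

theorem abs_le_mul_pow_succ_of_hasDerivWithinAt {n : ℕ} (hS : Convex ℝ S) (ht : t ∈ S)
    (hs : s ∈ S) (hC : 0 ≤ C) (hgt : g t = 0) (hg : ∀ x ∈ S, HasDerivWithinAt g (g₁ x) S x)
    (hg₁ : ∀ x ∈ S, |g₁ x| ≤ C * |x - t| ^ n) : |g s| ≤ C * |s - t| ^ (n + 1) := by
  have hsub : uIcc t s ⊆ S := hS.ordConnected.uIcc_subset ht hs
  have hle := (convex_uIcc t s).norm_image_sub_le_of_norm_hasDerivWithin_le
    (C := C * |s - t| ^ n) (fun x hx => (hg x (hsub hx)).mono hsub)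
    (fun x hx => (hg₁ x (hsub hx)).trans (by
      gcongr C * ?_ ^ n
      exact abs_sub_left_of_mem_uIcc hx)) left_mem_uIcc right_mem_uIcc
  rwa [hgt, sub_zero, Real.norm_eq_abs, Real.norm_eq_abs, mul_assoc, ← pow_succ] at hle

theorem abs_sub_taylor_one_le (hS : Convex ℝ S) (hg : ∀ x ∈ S, HasDerivWithinAt g (g₁ x) S x)
    (hg₁ : ∀ x ∈ S, HasDerivWithinAt g₁ (g₂ x) S x) (hC : ∀ x ∈ S, |g₂ x| ≤ C)
    (ht : t ∈ S) (hs : s ∈ S) : |g s - (g t + g₁ t * (s - t))| ≤ C * |s - t| ^ 2 := by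
  have hC₀ : 0 ≤ C := (abs_nonneg _).trans (hC t ht)
  have lipschitz : ∀ x ∈ S, |g₁ x - g₁ t| ≤ C * |x - t| ^ (0 + 1) := fun x hx =>
    abs_le_mul_pow_succ_of_hasDerivWithinAt (g := fun x => g₁ x - g₁ t) hS ht hx hC₀
      (sub_self _) (fun y hy => (hg₁ y hy).sub_const _)
      fun y hy => by simpa only [pow_zero, mul_one] using hC y hy
  refine abs_le_mul_pow_succ_of_hasDerivWithinAt (g := fun x => g x - (g t + g₁ t * (x - t)))
    hS ht hs hC₀ (by ring) (fun x hx => (hg x hx).sub ?_) lipschitz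
  have hlin : HasDerivAt (fun y => y - t) 1 x := (hasDerivAt_id x).sub_const t
  simpa only [mul_one] using ((hlin.const_mul (g₁ t)).const_add (g t)).hasDerivWithinAt

theorem abs_sub_taylor_two_le (hS : Convex ℝ S) (hg : ∀ x ∈ S, HasDerivWithinAt g (g₁ x) S x)
    (hg₁ : ∀ x ∈ S, HasDerivWithinAt g₁ (g₂ x) S x)
    (hg₂ : ∀ x ∈ S, HasDerivWithinAt g₂ (g₃ x) S x) (hC : ∀ x ∈ S, |g₃ x| ≤ C)
    (ht : t ∈ S) (hs : s ∈ S) :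
    |g s - (g t + g₁ t * (s - t) + g₂ t / 2 * (s - t) ^ 2)| ≤ C * |s - t| ^ 3 := by
  refine abs_le_mul_pow_succ_of_hasDerivWithinAt
    (g := fun x => g x - (g t + g₁ t * (x - t) + g₂ t / 2 * (x - t) ^ 2)) hS ht hs
    ((abs_nonneg _).trans (hC t ht)) (by ring) (fun x hx => (hg x hx).sub ?_)
    fun x hx => abs_sub_taylor_one_le hS hg₁ hg₂ hC ht hx
  have hlin : HasDerivAt (fun y => y - t) 1 x := (hasDerivAt_id x).sub_const t
  refine (((hlin.const_mul (g₁ t)).const_add (g t)).add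
    ((hlin.pow 2).const_mul (g₂ t / 2))).hasDerivWithinAt.congr_deriv ?_
  push_cast
  ring

theorem abs_sub_average_le (hS : Convex ℝ S) (hg : ∀ x ∈ S, HasDerivWithinAt g (g₁ x) S x)
    (hg₁ : ∀ x ∈ S, HasDerivWithinAt g₁ (g₂ x) S x) (hC : ∀ x ∈ S, |g₂ x| ≤ C)
    (ht : t ∈ S) (hm : t - h ∈ S) (hp : t + h ∈ S) :
    |g t - (g (t + h) + g (t - h)) / 2| ≤ C * h ^ 2 := by
  have forward := abs_sub_taylor_one_le hS hg hg₁ hC ht hp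
  have backward := abs_sub_taylor_one_le hS hg hg₁ hC ht hm
  rw [add_sub_cancel_left, sq_abs] at forward
  rw [sub_sub_cancel_left, abs_neg, sq_abs] at backward
  rw [abs_le] at *
  constructor <;> linarith

theorem abs_central_difference_sub_le (hS : Convex ℝ S)
    (hg : ∀ x ∈ S, HasDerivWithinAt g (g₁ x) S x)
    (hg₁ : ∀ x ∈ S, HasDerivWithinAt g₁ (g₂ x) S x)
    (hg₂ : ∀ x ∈ S, HasDerivWithinAt g₂ (g₃ x) S x) (hC : ∀ x ∈ S, |g₃ x| ≤ C)
    (hh : 0 ≤ h) (ht : t ∈ S) (hm : t - h ∈ S) (hp : t + h ∈ S) :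
    |g (t + h) - g (t - h) - 2 * h * g₁ t| ≤ 2 * C * h ^ 3 := by
  have forward := abs_sub_taylor_two_le hS hg hg₁ hg₂ hC ht hp
  have backward := abs_sub_taylor_two_le hS hg hg₁ hg₂ hC ht hm
  rw [add_sub_cancel_left, abs_of_nonneg hh] at forward
  rw [sub_sub_cancel_left, abs_neg, abs_of_nonneg hh] at backward
  rw [abs_le] at *
  constructor <;> linarith

theorem sq_mul_abs_deriv_two_le {B : ℝ} (hS : Convex ℝ S)
    (hg : ∀ x ∈ S, HasDerivWithinAt g (g₁ x) S x)
    (hg₁ : ∀ x ∈ S, HasDerivWithinAt g₁ (g₂ x) S x)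
    (hg₂ : ∀ x ∈ S, HasDerivWithinAt g₂ (g₃ x) S x) (hB : ∀ x ∈ S, |g x| ≤ B)
    (hC : ∀ x ∈ S, |g₃ x| ≤ C) (hh : 0 ≤ h) (ht : t ∈ S) (hm : t - h ∈ S) (hp : t + h ∈ S) :
    h ^ 2 * |g₂ t| ≤ 4 * B + 2 * C * h ^ 3 := by
  have forward := abs_sub_taylor_two_le hS hg hg₁ hg₂ hC ht hp
  have backward := abs_sub_taylor_two_le hS hg hg₁ hg₂ hC ht hm
  rw [add_sub_cancel_left, abs_of_nonneg hh] at forward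
  rw [sub_sub_cancel_left, abs_neg, abs_of_nonneg hh] at backward
  have hBt := hB t ht
  have hBm := hB _ hm
  have hBp := hB _ hp
  rw [← abs_of_nonneg (sq_nonneg h), ← abs_mul]
  rw [abs_le] at *
  constructor <;> linarith

theorem abs_deriv_two_le {B : ℝ} (hg : ∀ x ∈ Icc 0 1, HasDerivWithinAt g (g₁ x) (Icc 0 1) x)
    (hg₁ : ∀ x ∈ Icc 0 1, HasDerivWithinAt g₁ (g₂ x) (Icc 0 1) x)
    (hg₂ : ∀ x ∈ Icc 0 1, HasDerivWithinAt g₂ (g₃ x) (Icc 0 1) x) (hB : ∀ x ∈ Icc 0 1, |g x| ≤ B)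
    (hC : ∀ x ∈ Icc 0 1, |g₃ x| ≤ C) (hs : s ∈ Icc 0 1) : |g₂ s| ≤ 16 * B + 2 * C := by
  have hC₀ : 0 ≤ C := (abs_nonneg _).trans (hC s hs)
  have hmid : (1 / 2 : ℝ) ∈ Icc 0 1 := by constructor <;> norm_num
  have at_mid : (1 / 2) ^ 2 * |g₂ (1 / 2)| ≤ 4 * B + 2 * C * (1 / 2) ^ 3 :=
    sq_mul_abs_deriv_two_le (convex_Icc 0 1) hg hg₁ hg₂ hB hC (by norm_num) hmid
      (by norm_num) (by norm_num)
  have lipschitz : |g₂ s - g₂ (1 / 2)| ≤ C * |s - 1 / 2| ^ (0 + 1) :=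
    abs_le_mul_pow_succ_of_hasDerivWithinAt (g := fun x => g₂ x - g₂ (1 / 2)) (convex_Icc 0 1)
      hmid hs hC₀ (sub_self _) (fun y hy => (hg₂ y hy).sub_const _)
      fun y hy => by simpa only [pow_zero, mul_one] using hC y hy
  have hdist : C * |s - 1 / 2| ≤ C * (1 / 2) :=
    mul_le_mul_of_nonneg_left (abs_le.2 ⟨by linarith [hs.1], by linarith [hs.2]⟩) hC₀
  rw [zero_add, pow_one] at lipschitz
  linarith [abs_sub_abs_le_abs_sub (g₂ s) (g₂ (1 / 2))]

theorem hasDerivWithinAt_iteratedDerivWithin {n m : ℕ} (hS : UniqueDiffOn ℝ S)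
    (hg : ContDiffOn ℝ n g S) (hm : m < n) (hs : s ∈ S) :
    HasDerivWithinAt (iteratedDerivWithin m g S) (iteratedDerivWithin (m + 1) g S s) S s := by
  rw [iteratedDerivWithin_succ]
  exact (hg.differentiableOn_iteratedDerivWithin (mod_cast hm) hS s hs).hasDerivWithinAt

theorem TimeRegular.exists_bound_differences {a b B : ℝ} {u : ℝ → ℝ → ℝ} (hab : a < b)
    (htime : TimeRegular a b u) (hB : ∀ x ∈ Ioo a b, ∀ t ∈ Icc (0 : ℝ) 1, |u x t| ≤ B) :
    ∃ C, 0 ≤ C ∧ ∀ x ∈ Ioo a b, ∀ t h, 0 ≤ h → t - h ∈ Icc (0 : ℝ) 1 → t + h ∈ Icc (0 : ℝ) 1 →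
      |u x t - (u x (t + h) + u x (t - h)) / 2| ≤ C * h ^ 2 ∧
      ∀ d, HasDerivAt (u x) d t → |u x (t + h) - u x (t - h) - 2 * h * d| ≤ C * h ^ 3 := by
  obtain ⟨hcont, K, hK⟩ := htime
  obtain ⟨x₀, hx₀⟩ := nonempty_Ioo.2 hab
  have hzero : (0 : ℝ) ∈ Icc (0 : ℝ) 1 := left_mem_Icc.2 zero_le_one
  have hB₀ : 0 ≤ B := (abs_nonneg _).trans (hB x₀ hx₀ 0 hzero)
  have hK₀ : 0 ≤ K := (abs_nonneg _).trans (hK x₀ hx₀ 0 hzero)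
  have hS : UniqueDiffOn ℝ (Icc (0 : ℝ) 1) := uniqueDiffOn_Icc zero_lt_one
  refine ⟨16 * B + 2 * K, by positivity, fun x hx t h hh hm hp => ?_⟩
  have ht : t ∈ Icc (0 : ℝ) 1 := ⟨by linarith [hm.1], by linarith [hp.2]⟩
  have deriv₁ := fun s hs => hasDerivWithinAt_iteratedDerivWithin (n := 3) (m := 0) (s := s)
    hS (hcont x hx) (by norm_num) hs
  have deriv₂ := fun s hs => hasDerivWithinAt_iteratedDerivWithin (n := 3) (m := 1) (s := s)
    hS (hcont x hx) (by norm_num) hs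
  have deriv₃ := fun s hs => hasDerivWithinAt_iteratedDerivWithin (n := 3) (m := 2) (s := s)
    hS (hcont x hx) (by norm_num) hs
  rw [iteratedDerivWithin_zero] at deriv₁
  refine ⟨abs_sub_average_le (convex_Icc 0 1) deriv₁ deriv₂ (fun s hs =>
    abs_deriv_two_le deriv₁ deriv₂ deriv₃ (hB x hx) (hK x hx) hs) ht hm hp, fun d hd => ?_⟩
  rw [(hS t ht).eq_deriv _ hd.hasDerivWithinAt (deriv₁ t ht)]
  exact (abs_central_difference_sub_le (convex_Icc 0 1) deriv₁ deriv₂ deriv₃ (hK x hx)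
    hh ht hm hp).trans (by gcongr; linarith)

end TimeDifferences

/-! ### Consistency and convergence -/

section Consistency

variable {a b α σ r K : ℝ} {N : ℕ} {u₀ v v₁ v₂ : ℝ → ℝ} {f u : ℝ → ℝ → ℝ}

theorem nonlocalOp_eq (a b α : ℝ) (v : ℝ → ℝ) (x : ℝ) :
    nonlocalOp a b α v x = ∫ y in a..b, (v y - v x) * |x - y| ^ (-α) := by
  simp only [nonlocalOp, div_abs_rpow_eq]

theorem WeightedC2.intervalIntegrable_sub_mul_kernel (h : WeightedC2 a b σ K v) (hab : a < b)
    (hσ : 0 ≤ σ) (hα : α < 1) (c x : ℝ) :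
    IntervalIntegrable (fun y => (v y - c) * |x - y| ^ (-α)) volume a b :=
  intervalIntegrable_mul_kernel (B := K * ((b - a) * (b - a)) ^ σ + |c|) hα x hab.le
    (h.aestronglyMeasurable.sub aestronglyMeasurable_const) fun y _ =>
      (abs_sub _ _).trans (add_le_add (h.abs_le_const hab hσ y) le_rfl)

theorem abs_nonlocalOp_sub_average_le {δ : ℝ} (h : WeightedC2 a b σ K v)
    (h₁ : WeightedC2 a b σ K v₁) (h₂ : WeightedC2 a b σ K v₂) (hab : a < b) (hσ : 0 ≤ σ)
    (hα₀ : 0 ≤ α) (hα : α < 1) (hδ : ∀ y, |v y - (v₁ y + v₂ y) / 2| ≤ δ) (x : ℝ) :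
    |nonlocalOp a b α v x - (nonlocalOp a b α v₁ x + nonlocalOp a b α v₂ x) / 2| ≤
      2 * δ * (2 / (1 - α) * (b - a) ^ (1 - α)) := by
  have hint := h.intervalIntegrable_sub_mul_kernel hab hσ hα (v x) x
  have hint₁ := h₁.intervalIntegrable_sub_mul_kernel hab hσ hα (v₁ x) x
  have hint₂ := h₂.intervalIntegrable_sub_mul_kernel hab hσ hα (v₂ x) x
  have hδ₀ : 0 ≤ δ := (abs_nonneg _).trans (hδ x)
  have eq_integral :
      nonlocalOp a b α v x - (nonlocalOp a b α v₁ x + nonlocalOp a b α v₂ x) / 2 =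
        ∫ y in a..b, ((v y - (v₁ y + v₂ y) / 2) - (v x - (v₁ x + v₂ x) / 2)) *
          |x - y| ^ (-α) := by
    rw [nonlocalOp_eq, nonlocalOp_eq, nonlocalOp_eq, ← intervalIntegral.integral_add hint₁ hint₂,
      ← intervalIntegral.integral_div,
      ← intervalIntegral.integral_sub hint ((hint₁.add hint₂).div_const 2)]
    congr 1
    ext y
    ring
  rw [eq_integral]
  exact abs_integral_mul_kernel_le hα₀ hα x hab.le (by positivity) fun y _ =>
    (abs_sub _ _).trans (by linarith [hδ y, hδ x])

/-- The vector of the values of `v` at the interior nodes, indexed like `stiffness`. -/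
noncomputable def nodalValues (a b r : ℝ) (N : ℕ) (v : ℝ → ℝ) : Fin (2 * N - 1) → ℝ :=
  fun i => v (node a b r N (i + 1))

theorem stiffness_mulVec_nodalValues (h : WeightedC2 a b σ K v) (hab : a < b) (hσ : 0 ≤ σ)
    (hr : 0 < r) (hα : α < 1) (i : Fin (2 * N - 1)) :
    (stiffness a b α r N).mulVec (nodalValues a b r N v) i =
      (∫ y in a..b, interpError (node a b r N) (2 * N) v y *
        |node a b r N (i + 1) - y| ^ (-α)) - nonlocalOp a b α v (node a b r N (i + 1)) := by
  have hN : 1 ≤ N := by have := i.isLt; omega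
  rw [nonlocalOp_eq, ← intervalIntegral.integral_sub
    (h.intervalIntegrable_interpError_mul_kernel hab hσ hr hN hα _)
    (h.intervalIntegrable_sub_mul_kernel hab hσ hα _ _)]
  refine (stiffness_mulVec hab hα (v ∘ node a b r N) i).trans ?_
  rw [interp_node (node_strictMonoOn hab hr hN) (by omega) (by omega)]
  simp only [interpError, Function.comp_apply]
  congr 1
  ext y
  ring

theorem exists_bound_space_defect (hab : a < b) (hσ : 0 ≤ σ) (hr : 0 < r) (hα₀ : 0 ≤ α)
    (hα : α < 1) :
    ∃ C, 0 ≤ C ∧ ∀ (K : ℝ) (v : ℝ → ℝ) (N : ℕ) (i : Fin (2 * N - 1)), WeightedC2 a b σ K v →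
      (r * (1 + σ - α) = 2 → 2 ≤ N) →
      |(stiffness a b α r N).mulVec (nodalValues a b r N v) i +
        nonlocalOp a b α v (node a b r N (i + 1))| ≤ K * C * gradedRate (r * (1 + σ - α)) N := by
  obtain ⟨C, hC, bound⟩ := WeightedC2.exists_bound_integral_interpError hab hσ hr hα₀ hα
  refine ⟨C, hC, fun K v N i h hN₂ => ?_⟩
  rw [stiffness_mulVec_nodalValues h hab hσ hr hα, sub_add_cancel]
  have := i.isLt
  exact bound K v N (i + 1) h (by omega) hN₂ (by omega) (by omega)

theorem exists_bound_time_defect (hab : a < b) (hσ : 0 ≤ σ) (hα₀ : 0 ≤ α) (hα : α < 1)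
    (hsol : IsSolution a b α u₀ f u) (htime : TimeRegular a b u)
    (hspace : ∀ t ∈ Icc (0 : ℝ) 1, WeightedC2 a b σ K fun x => u x t) :
    ∃ C, 0 ≤ C ∧ ∀ x ∈ Ioo a b, ∀ t τ, 0 < τ → t - τ / 2 ∈ Icc (0 : ℝ) 1 →
      t + τ / 2 ∈ Icc (0 : ℝ) 1 →
      |τ⁻¹ * (u x (t + τ / 2) - u x (t - τ / 2)) -
        (nonlocalOp a b α (fun y => u y (t + τ / 2)) x +
          nonlocalOp a b α (fun y => u y (t - τ / 2)) x) / 2 - f x t| ≤ C * τ ^ 2 := by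
  obtain ⟨C, hC, bound⟩ := htime.exists_bound_differences hab
    fun x _ t ht => (hspace t ht).abs_le_const hab hσ x
  set D := 2 / (1 - α) * (b - a) ^ (1 - α)
  have : 0 ≤ D := mul_nonneg (div_nonneg two_pos.le (sub_nonneg.2 hα.le))
    (Real.rpow_nonneg (sub_nonneg.2 hab.le) _)
  refine ⟨C * (1 + D), by positivity, fun x hx t τ hτ hm hp => ?_⟩
  have ht : t ∈ Ioo (0 : ℝ) 1 := ⟨by linarith [hm.1], by linarith [hp.2]⟩
  have ht' := Ioo_subset_Icc_self ht
  have quotient : |τ⁻¹ * (u x (t + τ / 2) - u x (t - τ / 2)) -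
      (nonlocalOp a b α (fun y => u y t) x + f x t)| ≤ C * τ ^ 2 := by
    have := (bound x hx t (τ / 2) (by positivity) hm hp).2 _ (hsol.equation x hx t ht)
    rw [show ∀ p q : ℝ, τ⁻¹ * p - q = τ⁻¹ * (p - 2 * (τ / 2) * q) by intros; field_simp,
      abs_mul, abs_of_pos (inv_pos.2 hτ)]
    calc τ⁻¹ * _ ≤ τ⁻¹ * (C * (τ / 2) ^ 3) := by gcongr
      _ = C * τ ^ 2 / 8 := by field_simp; norm_num
      _ ≤ C * τ ^ 2 := by linarith [show 0 ≤ C * τ ^ 2 by positivity]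
  have average : ∀ y, |u y t - (u y (t + τ / 2) + u y (t - τ / 2)) / 2| ≤ C * (τ / 2) ^ 2 := by
    intro y
    by_cases hy : y ∈ Ioo a b
    · exact (bound y hy t (τ / 2) (by positivity) hm hp).1
    · rw [hsol.exterior y hy _ ht', hsol.exterior y hy _ hp, hsol.exterior y hy _ hm, add_zero,
        zero_div, sub_zero, abs_zero]
      positivity
  have operator := abs_nonlocalOp_sub_average_le (hspace t ht') (hspace _ hp) (hspace _ hm) hab hσ
    hα₀ hα average x
  have hDτ : 0 ≤ C * D * τ ^ 2 := by positivity
  rw [abs_le] at *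
  constructor <;> linarith

theorem exists_bound_crankNicolsonResidual (hab : a < b) (hσ : 0 ≤ σ) (hr : 0 < r)
    (hα₀ : 0 ≤ α) (hα : α < 1) (hsol : IsSolution a b α u₀ f u) (hspace : SpaceRegular a b σ u)
    (htime : TimeRegular a b u) :
    ∃ C, 0 ≤ C ∧ ∀ (N : ℕ) (t τ : ℝ), (r * (1 + σ - α) = 2 → 2 ≤ N) → 0 < τ →
      t - τ / 2 ∈ Icc (0 : ℝ) 1 → t + τ / 2 ∈ Icc (0 : ℝ) 1 →
      ‖crankNicolsonResidual (stiffness a b α r N) τ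
        (nodalValues a b r N fun x => u x (t - τ / 2))
        (nodalValues a b r N fun x => u x (t + τ / 2)) (load a b r f N t)‖ ≤
        C * (gradedRate (r * (1 + σ - α)) N + τ ^ 2) := by
  obtain ⟨K, hweighted⟩ := exists_weightedC2 hsol hspace
  obtain ⟨C₁, hC₁, time_defect⟩ := exists_bound_time_defect hab hσ hα₀ hα hsol htime hweighted
  obtain ⟨C₂, hC₂, space_defect⟩ := exists_bound_space_defect hab hσ hr hα₀ hα
  have hK : 0 ≤ K := (hweighted 0 (left_mem_Icc.2 zero_le_one)).nonneg hab
  refine ⟨C₁ + K * C₂, by positivity, fun N t τ hN₂ hτ hm hp => ?_⟩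
  set ε := gradedRate (r * (1 + σ - α)) N
  have hε : 0 ≤ ε := gradedRate_nonneg _ N
  refine (pi_norm_le_iff_of_nonneg (by positivity)).2 fun i => ?_
  have htime := time_defect (node a b r N (i + 1))
    (node_mem_Ioo hab hr (by omega) (by omega)) t τ hτ hm hp
  have hprev := space_defect K _ N i (hweighted _ hm) hN₂
  have hnext := space_defect K _ N i (hweighted _ hp) hN₂
  have hcross : 0 ≤ C₁ * ε + K * C₂ * τ ^ 2 := by positivity
  simp only [crankNicolsonResidual, Matrix.mulVec_add, Pi.sub_apply, Pi.add_apply, Pi.smul_apply,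
    smul_eq_mul, Real.norm_eq_abs, load]
  rw [abs_le] at *
  simp only [nodalValues] at *
  constructor <;> linarith

end Consistency

section Convergence

variable {a b α σ r : ℝ} {u₀ : ℝ → ℝ} {f u : ℝ → ℝ → ℝ}

theorem isRowDominant_stiffness {N : ℕ} (hab : a < b) (hα : α < 1) (hr : 0 < r) :
    IsRowDominant (stiffness a b α r N) :=
  isRowDominant_of_nonpos
    (fun i k hik => coeff_nonpos hab hr (by omega) (by omega) (by omega)
      fun h => hik (Fin.ext (Nat.succ_injective h.symm)))
    (sum_stiffness_nonneg hab hα hr)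

theorem IsSchemeSolution.norm_sub_le {N M : ℕ} {ρ : ℝ} {U V : ℕ → Fin (2 * N - 1) → ℝ}
    (hab : a < b) (hα₀ : 0 ≤ α) (hα : α < 1) (hr : 0 < r) (hρ : 0 ≤ ρ)
    (hU : IsSchemeSolution a b α r u₀ f N M U) (hV₀ : V 0 = nodalValues a b r N u₀)
    (hV : ∀ j < M, ‖crankNicolsonResidual (stiffness a b α r N) (1 / M) (V j) (V (j + 1))
      (load a b r f N (((j + 1 : ℕ) - 1 / 2) * (1 / M)))‖ ≤ ρ) {k : ℕ} (hk : k ≤ M) :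
    ‖V k - U k‖ ≤ Real.exp (2 / (1 - α) * (b - a) ^ (1 - α)) * ρ := by
  rcases k.eq_zero_or_pos with rfl | hk₀
  · rw [hV₀, show U 0 = nodalValues a b r N u₀ from funext hU.1, sub_self, norm_zero]
    positivity
  set D := 2 / (1 - α) * (b - a) ^ (1 - α)
  have hD : 0 ≤ D := mul_nonneg (div_nonneg two_pos.le (sub_nonneg.2 hα.le))
    (Real.rpow_nonneg (sub_nonneg.2 hab.le) _)
  have hM : (0 : ℝ) < M := by exact_mod_cast hk₀.trans_le hk
  have elapsed_le : k * (1 / (M : ℝ)) ≤ 1 := by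
    rw [mul_one_div]
    exact (div_le_one hM).2 (mod_cast hk)
  have stable := (isRowDominant_stiffness hab hα hr).norm_crankNicolson_le hD
    (fun i => coeff_self_le hab hα₀ hα hr (by omega) (by omega)) (by positivity) hρ
    (e := fun j => V j - U j) (sub_eq_zero.2 (hV₀.trans (funext hU.1).symm))
    (fun j hj => crankNicolson_error_step (by positivity) (hU.2 (j + 1) (by omega) hj)) hV hk
  calc ‖V k - U k‖ ≤ Real.exp (k * (1 / M) * D) * (k * (1 / M) * ρ) := stable
    _ ≤ Real.exp (1 * D) * (1 * ρ) := by gcongr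
    _ = Real.exp D * ρ := by rw [one_mul, one_mul]

theorem exists_bound_error (hab : a < b) (hα₀ : 0 ≤ α) (hα : α < 1) (hσ : 0 ≤ σ) (hr : 0 < r)
    (hsol : IsSolution a b α u₀ f u) (hspace : SpaceRegular a b σ u) (htime : TimeRegular a b u) :
    ∃ C, 0 < C ∧ ∀ N M : ℕ, (r * (1 + σ - α) = 2 → 2 ≤ N) → 1 ≤ M →
      ∀ U, IsSchemeSolution a b α r u₀ f N M U → ∀ (i : Fin (2 * N - 1)) (k : ℕ), k ≤ M →
        |u (node a b r N (i + 1)) (k * (1 / M)) - U k i| ≤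
          C * (gradedRate (r * (1 + σ - α)) N + (M : ℝ) ^ (-2 : ℝ)) := by
  obtain ⟨C, hC, residual⟩ :=
    exists_bound_crankNicolsonResidual hab hσ hr hα₀ hα hsol hspace htime
  set D := 2 / (1 - α) * (b - a) ^ (1 - α)
  refine ⟨Real.exp D * (C + 1), by positivity, fun N M hN₂ hM U hU i k hk => ?_⟩
  have hM₀ : (0 : ℝ) < M := by exact_mod_cast hM
  have hrate : 0 ≤ gradedRate (r * (1 + σ - α)) N + (M : ℝ) ^ (-2 : ℝ) :=
    add_nonneg (gradedRate_nonneg _ N) (by positivity)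
  let V : ℕ → Fin (2 * N - 1) → ℝ := fun j => nodalValues a b r N fun x => u x (j * (1 / M))
  have initial : V 0 = nodalValues a b r N u₀ := funext fun i => by
    simp only [V, nodalValues, Nat.cast_zero, zero_mul]
    exact hsol.initial _ (node_mem_Ioo hab hr (by omega) (by omega))
  have time_le : ∀ j ≤ M, j * (1 / (M : ℝ)) ≤ 1 := fun j hj => by
    rw [mul_one_div]
    exact (div_le_one hM₀).2 (mod_cast hj)
  have consistent : ∀ j < M, ‖crankNicolsonResidual (stiffness a b α r N) (1 / M) (V j) (V (j + 1))
      (load a b r f N (((j + 1 : ℕ) - 1 / 2) * (1 / M)))‖ ≤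
        (C + 1) * (gradedRate (r * (1 + σ - α)) N + (M : ℝ) ^ (-2 : ℝ)) := fun j hj => by
    have := residual N (((j + 1 : ℕ) - 1 / 2) * (1 / M)) (1 / M) hN₂ (by positivity)
    rw [show ((j + 1 : ℕ) - 1 / 2) * (1 / (M : ℝ)) - 1 / M / 2 = j * (1 / M) by push_cast; ring,
      show ((j + 1 : ℕ) - 1 / 2) * (1 / (M : ℝ)) + 1 / M / 2 = (j + 1 : ℕ) * (1 / M) by ring,
      show (1 / (M : ℝ)) ^ 2 = (M : ℝ) ^ (-2 : ℝ) by
        rw [Real.rpow_neg hM₀.le, Real.rpow_two, one_div, inv_pow]] at this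
    exact (this ⟨by positivity, time_le j hj.le⟩ ⟨by positivity, time_le (j + 1) hj⟩).trans
      (mul_le_mul_of_nonneg_right (le_add_of_nonneg_right zero_le_one) hrate)
  rw [mul_assoc]
  exact (norm_le_pi_norm (V k - U k) i).trans
    (hU.norm_sub_le hab hα₀ hα hr (by positivity) initial consistent hk)

end Convergence

end NonlocalCN

theorem theorem5p2_general (a b α σ r : ℝ) (hab : a < b) (hα₀ : 0 ≤ α) (hα₁ : α < 1)
    (hσ₀ : 0 ≤ σ) (hr : 0 < r)
    (u₀ : ℝ → ℝ) (f u : ℝ → ℝ → ℝ)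
    (hsol : NonlocalCN.IsSolution a b α u₀ f u)
    (hspace : NonlocalCN.SpaceRegular a b σ u)
    (htime : NonlocalCN.TimeRegular a b u) :
    ∃ C : ℝ, 0 < C ∧ ∀ N M : ℕ, 1 ≤ M → ∀ U : ℕ → Fin (2 * N - 1) → ℝ,
      NonlocalCN.IsSchemeSolution a b α r u₀ f N M U →
      ∀ (i : Fin (2 * N - 1)) (k : ℕ), k ≤ M →
        (r * (1 + σ - α) < 2 →
          |u (NonlocalCN.node a b r N (i + 1)) ((k : ℝ) * (1 / (M : ℝ))) - U k i| ≤
            C * ((N : ℝ) ^ (-(r * (1 + σ - α))) + (M : ℝ) ^ (-2 : ℝ))) ∧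
        (r * (1 + σ - α) = 2 → 2 ≤ N →
          |u (NonlocalCN.node a b r N (i + 1)) ((k : ℝ) * (1 / (M : ℝ))) - U k i| ≤
            C * ((N : ℝ) ^ (-(r * (1 + σ - α))) * Real.log N + (M : ℝ) ^ (-2 : ℝ))) ∧
        (2 < r * (1 + σ - α) →
          |u (NonlocalCN.node a b r N (i + 1)) ((k : ℝ) * (1 / (M : ℝ))) - U k i| ≤
            C * ((N : ℝ) ^ (-2 : ℝ) + (M : ℝ) ^ (-2 : ℝ))) := by
  obtain ⟨C, hC, bound⟩ :=
    NonlocalCN.exists_bound_error hab hα₀ hα₁ hσ₀ hr hsol hspace htime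
  refine ⟨C, hC, fun N M hM U hU i k hk => ⟨fun hβ => ?_, fun hβ hN₂ => ?_, fun hβ => ?_⟩⟩
  · have := bound N M (fun h => absurd h hβ.ne) hM U hU i k hk
    rwa [NonlocalCN.gradedRate, min_eq_left hβ.le, if_neg hβ.ne, mul_one] at this
  · have := bound N M (fun _ => hN₂) hM U hU i k hk
    rwa [NonlocalCN.gradedRate, min_eq_left hβ.le, if_pos hβ] at this
  · have := bound N M (fun h => absurd h hβ.ne') hM U hU i k hk
    rwa [NonlocalCN.gradedRate, min_eq_right hβ.le, if_neg hβ.ne', mul_one] at this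

theorem theorem5p2 (a b α σ r : ℝ) (hab : a < b) (hα₀ : 0 < α) (hα₁ : α < 1)
    (hσ₀ : 0 < σ) (hσ₁ : σ < 1) (hr : 0 < r)
    (u₀ : ℝ → ℝ) (f u : ℝ → ℝ → ℝ)
    (hsol : NonlocalCN.IsSolution a b α u₀ f u)
    (hspace : NonlocalCN.SpaceRegular a b σ u)
    (htime : NonlocalCN.TimeRegular a b u) :
    ∃ C : ℝ, 0 < C ∧ ∀ N M : ℕ, 1 ≤ N → 1 ≤ M → ∀ U : ℕ → Fin (2 * N - 1) → ℝ,
      NonlocalCN.IsSchemeSolution a b α r u₀ f N M U →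
      ∀ (i : Fin (2 * N - 1)) (k : ℕ), 1 ≤ k → k ≤ M →
        (r * (1 + σ - α) < 2 →
          |u (NonlocalCN.node a b r N (i + 1)) ((k : ℝ) * (1 / (M : ℝ))) - U k i| ≤
            C * ((N : ℝ) ^ (-(r * (1 + σ - α))) + (M : ℝ) ^ (-2 : ℝ))) ∧
        (r * (1 + σ - α) = 2 → 2 ≤ N →
          |u (NonlocalCN.node a b r N (i + 1)) ((k : ℝ) * (1 / (M : ℝ))) - U k i| ≤
            C * ((N : ℝ) ^ (-(r * (1 + σ - α))) * Real.log N + (M : ℝ) ^ (-2 : ℝ))) ∧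
        (2 < r * (1 + σ - α) →
          |u (NonlocalCN.node a b r N (i + 1)) ((k : ℝ) * (1 / (M : ℝ))) - U k i| ≤
            C * ((N : ℝ) ^ (-2 : ℝ) + (M : ℝ) ^ (-2 : ℝ))) :=
  let ⟨C, hC, bound⟩ :=
    theorem5p2_general a b α σ r hab hα₀.le hα₁ hσ₀.le hr u₀ f u hsol hspace htime
  ⟨C, hC, fun N M _ hM U hU i k _ hk => bound N M hM U hU i k hk⟩
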